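/- Write points of $\mathbb{C}^2$ as $(z,w)=(x+iy,\,u+iv)$, with weights $[z]=[\bar z]=1$, $[u]=2$: a function of $(z,u)$ near $0$ is $O(6)$ if it is bounded near $0$ by a constant times $|z|^6+|u|^3$. Let $M=\{v=F(z,\bar z,u)\}\subset\mathbb{C}^2$ be a hypersurface graphed by a real-analytic real-valued function $F$ on an open set $D\subset\mathbb{C}_z\times\mathbb{R}_u$. Moser chains. A *normalizing map* at $p\in M$ is a local biholomorphism $\varphi$ at $p$ with $\varphi(p)=0$ that sends $M$ near $p$ onto a real-analytic hypersurface $v'=z'\bar z'+O(6)$ near $0$. It acts, by its second prolongation $\varphi^{(2)}$, on the 2-jets $(x_1,y_1,x_2,y_2)$ at $p$ of CR-transversal curves $u\mapsto(x(u),y(u),u)$ in $M$ (with intrinsic coordinates $(x,y,u)$). The chain locus at $p$ is $\Sigma_p:=(\varphi^{(2)})^{-1}(\Sigma_0)$, where $$\Sigma_0:=\{x_2=-2x_1^2y_1-2y_1^3,\quad y_2=2x_1y_1^2+2x_1^3\},$$ and does not depend on the normalizing map $\varphi$ at $p$. A curve $u\mapsto(x(u),y(u),u)$ of class $C^2$ in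 $M$, defined on an open interval, is a *Moser chain* if, for every $u$, the 2-jet $(\dot x,\dot y,\ddot x,\ddot y)(u)$ belongs to $\Sigma_p$ at the corresponding point $p\in M$. Let $J\ni 0$ be an open interval such that $F(0,0,u)=0$ for all $u\in J$, and assume that the $u$-axis $\{(0,u):u\in J\}\subset M$ is a Moser chain. Then: (1) If $F(z,\bar z,u)=z\bar z+F_{3,2,0}\,z^3\bar z^2+\overline{F_{3,2,0}}\,z^2\bar z^3+O(6)$ for some $F_{3,2,0}\in\mathbb{C}$, then $F_{3,2,0}=0$. (2) Let $F_{j,k}(u):=\frac{1}{j!\,k!}\,\partial_z^j\partial_{\bar z}^kF(0,0,u)$ be the coefficients of the expansion $F=\sum_{j,k}F_{j,k}(u)\,z^j\bar z^k$. If, for all $u\in J$, one has $F_{j,0}(u)=F_{0,k}(u)=0$ for all $j,k\ge 0$, $F_{j,1}(u)=0$ for all $j\neq1$, $F_{1,k}(u)=0$ for all $k\ne1$, $F_{1,1}(u)=1$ and $F_{2,2}(u)=0$, then $F_{3,2}(u)=F_{2,3}(u)=0$ for all $u\in J$. -/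

import Mathlib

open Complex Topology Asymptotics

noncomputable section

namespace MoserChain

/-- The hypersurface `{v = F(z, z̄, u)}` of `ℂ²`, `w = u + i v`, graphed over the set `D` of
parameters `(z, u)`. -/
def hypersurface (D : Set (ℂ × ℝ)) (F : ℂ × ℝ → ℝ) : Set (ℂ × ℂ) :=
  {q | (q.1, q.2.re) ∈ D ∧ q.2.im = F (q.1, q.2.re)}

/-- The point of the graph of `F` above `(z, u)`. -/
def graphPoint (F : ℂ × ℝ → ℝ) (m : ℂ × ℝ) : ℂ × ℂ :=
  (m.1, (m.2 : ℂ) + I * (F m : ℂ))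

/-- `R = O(6)` at the origin, for the weights `[z] = [z̄] = 1` and `[u] = 2`. -/
def IsWeightedO6 (R : ℂ × ℝ → ℝ) : Prop :=
  R =O[𝓝 (0 : ℂ × ℝ)] fun m => ‖m.1‖ ^ 6 + |m.2| ^ 3

/-- `φ` is (the germ at `p` of) a biholomorphism with `φ p = 0` which sends the hypersurface `M`
near `p` to a real-analytic hypersurface `v' = z' z̄' + O(6)` near `0`. -/
structure IsNormalizingMap (M : Set (ℂ × ℂ)) (p : ℂ × ℂ) (φ : ℂ × ℂ → ℂ × ℂ) : Prop where
  analyticAt : AnalyticAt ℂ φ p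
  map_base : φ p = 0
  invertible : (fderiv ℂ φ p).IsInvertible
  normalizes : ∃ G : ℂ × ℝ → ℝ, AnalyticAt ℝ G 0 ∧
    IsWeightedO6 (fun m => G m - normSq m.1) ∧
    ∀ᶠ q in 𝓝 p, (q ∈ M ↔ (φ q).2.im = G ((φ q).1, (φ q).2.re))

/-- Fibre coordinates `(x₁, y₁, x₂, y₂)` on the space of second order jets of curves
`u ↦ (x(u), y(u))`. -/
@[ext]
structure Jet2 where
  x₁ : ℝ
  y₁ : ℝ
  x₂ : ℝ
  y₂ : ℝ

/-- The cubic surface `Σ₀` in the fibre over `0` of the second jet space. -/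
def sigmaZero : Set Jet2 :=
  {j | j.x₂ = -2 * j.x₁ ^ 2 * j.y₁ - 2 * j.y₁ ^ 3 ∧ j.y₂ = 2 * j.x₁ * j.y₁ ^ 2 + 2 * j.x₁ ^ 3}

/-- The 2-jet at parameter `t` of the curve `(X, Y, U)` once it is graphed over the `U`-axis,
that is, `(dX/dU, dY/dU, d²X/dU², d²Y/dU²)`; meaningful when `deriv U t ≠ 0`. -/
def jetOfCurve (X Y U : ℝ → ℝ) (t : ℝ) : Jet2 where
  x₁ := deriv X t / deriv U t
  y₁ := deriv Y t / deriv U t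
  x₂ := (deriv (deriv X) t * deriv U t - deriv X t * deriv (deriv U) t) / deriv U t ^ 3
  y₂ := (deriv (deriv Y) t * deriv U t - deriv Y t * deriv (deriv U) t) / deriv U t ^ 3

/-- The curve in the graph of `F` whose projection to `(x, y, u)`-space is the quadratic curve
through `m = (z_p, u_p)` at time `0`, with `u = u_p + t`, representing the 2-jet `j`. -/
def representative (F : ℂ × ℝ → ℝ) (m : ℂ × ℝ) (j : Jet2) (t : ℝ) : ℂ × ℂ :=
  graphPoint F
    (m.1 + (t : ℂ) * ((j.x₁ : ℂ) + I * (j.y₁ : ℂ))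
        + ((t ^ 2 / 2 : ℝ) : ℂ) * ((j.x₂ : ℂ) + I * (j.y₂ : ℂ)),
      m.2 + t)

/-- The `u'`-component of the image under `φ` of the representative curve. -/
def imageU (φ : ℂ × ℂ → ℂ × ℂ) (F : ℂ × ℝ → ℝ) (m : ℂ × ℝ) (j : Jet2) (t : ℝ) : ℝ :=
  (φ (representative F m j t)).2.re

/-- The second prolongation `φ⁽²⁾` on the fibre of 2-jets above the point of the graph of `F` over
`m`, read in the coordinates `(x', y', u')` of the target. -/
def prolong2 (φ : ℂ × ℂ → ℂ × ℂ) (F : ℂ × ℝ → ℝ) (m : ℂ × ℝ) (j : Jet2) : Jet2 :=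
  jetOfCurve (fun t => (φ (representative F m j t)).1.re)
    (fun t => (φ (representative F m j t)).1.im) (imageU φ F m j) 0

/-- The chain locus `Σ_p = (φ⁽²⁾)⁻¹(Σ₀)` at the point `p` of the hypersurface above `m`, where `φ`
is a normalizing map at `p`. The condition `deriv (imageU φ F m j) 0 ≠ 0` says that the jet `j` is
CR-transversal (the complex tangent line of the normalized hypersurface at `0` is `{w' = 0}`). -/
def chainLocus (D : Set (ℂ × ℝ)) (F : ℂ × ℝ → ℝ) (m : ℂ × ℝ) : Set Jet2 :=
  {j | ∃ φ : ℂ × ℂ → ℂ × ℂ, IsNormalizingMap (hypersurface D F) (graphPoint F m) φ ∧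
    deriv (imageU φ F m j) 0 ≠ 0 ∧ prolong2 φ F m j ∈ sigmaZero}

/-- The curve `u ↦ (x(u), y(u), u)`, `u ∈ J`, in the hypersurface `v = F(z, z̄, u)` (with its
intrinsic coordinates `x, y, u`) is a Moser chain: it solves the second order system whose
2-jets at each point `p` are those of `Σ_p`. -/
structure IsMoserChain (D : Set (ℂ × ℝ)) (F : ℂ × ℝ → ℝ) (J : Set ℝ) (x y : ℝ → ℝ) : Prop where
  isOpen : IsOpen J
  ordConnected : J.OrdConnected
  contDiffOn_x : ContDiffOn ℝ 2 x J
  contDiffOn_y : ContDiffOn ℝ 2 y J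
  mem : ∀ u ∈ J, ((x u : ℂ) + I * (y u : ℂ), u) ∈ D
  jet_mem : ∀ u ∈ J,
    (⟨deriv x u, deriv y u, deriv (deriv x) u, deriv (deriv y) u⟩ : Jet2) ∈
      chainLocus D F ((x u : ℂ) + I * (y u : ℂ), u)

/-- The Wirtinger operator `∂/∂z = ½ (∂/∂x - i ∂/∂y)`. -/
def dz (G : ℂ × ℝ → ℂ) (m : ℂ × ℝ) : ℂ :=
  (1 / 2 : ℂ) * (fderiv ℝ G m (1, 0) - I * fderiv ℝ G m (I, 0))

/-- The Wirtinger operator `∂/∂z̄ = ½ (∂/∂x + i ∂/∂y)`. -/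
def dzbar (G : ℂ × ℝ → ℂ) (m : ℂ × ℝ) : ℂ :=
  (1 / 2 : ℂ) * (fderiv ℝ G m (1, 0) + I * fderiv ℝ G m (I, 0))

/-- The coefficient `F_{j,k}(u)` of the expansion `F(z, z̄, u) = ∑ F_{j,k}(u) z^j z̄^k`. -/
def coeff (F : ℂ × ℝ → ℝ) (j k : ℕ) (u : ℝ) : ℂ :=
  (dzbar^[k] (dz^[j] fun m => (F m : ℂ))) (0, u) / ((j.factorial : ℂ) * (k.factorial : ℂ))

/-- The normalizations `F_{j,0} ≡ F_{0,k} ≡ 0`, `F_{j,1} ≡ 0` for `j ≠ 1`, `F_{1,k} ≡ 0` for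
`k ≠ 1`, `F_{1,1} ≡ 1` and `F_{2,2} ≡ 0` on `J`. -/
structure IsPrenormalizedOn (F : ℂ × ℝ → ℝ) (J : Set ℝ) : Prop where
  coeff_zero_right : ∀ u ∈ J, ∀ j, coeff F j 0 u = 0
  coeff_zero_left : ∀ u ∈ J, ∀ k, coeff F 0 k u = 0
  coeff_one_right : ∀ u ∈ J, ∀ j, j ≠ 1 → coeff F j 1 u = 0
  coeff_one_left : ∀ u ∈ J, ∀ k, k ≠ 1 → coeff F 1 k u = 0
  coeff_one_one : ∀ u ∈ J, coeff F 1 1 u = 1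
  coeff_two_two : ∀ u ∈ J, coeff F 2 2 u = 0

end MoserChain

end

/-!
`Σ₀` consists of the 2-jets at `0` of the curves cut out on `v = |z|²` by complex lines through
`0`. Hence, if `φ = (f, g)` normalizes `M` at `0`, with `f = ∑ c_{ij} zⁱ wʲ` and
`g = ∑ d_{ij} zⁱ wʲ`, the `u`-axis satisfies the chain condition at `0` exactly when `φ` maps it to
a curve tangent to second order to a complex line, that is, when `c₀₁ d₀₂ = c₀₂ d₀₁`.

On `M`, the equation `Im g = |f|² + O(6)` of the target can be compared with that of the source one
weight at a time. In each weight `z` and `z̄` may be treated as independent variables, and on the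
slice `u = i z z̄`, where `w̄` vanishes while `w = 2 i z z̄`, the weights `2` to `5` combine to
`ā |c₁₀|⁴ = 4 c̄₁₀ (c₀₁ d₀₂ - c₀₂ d₀₁)`, where `a = F_{3,2,0}`. As `c₁₀ ≠ 0`, a chain forces
`a = 0`.

Under the normalizations of (2), Taylor expansion in `z` and `z̄` puts `M` in the form required by
(1) at every point of the axis, and translation along the axis reduces that point to the origin.
-/

noncomputable section

namespace MoserChain

open scoped ComplexConjugate
open Polynomial (C X)
open Finset (range)
open Finset.HasAntidiagonal (antidiagonal mem_antidiagonal)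

section Expansion

variable {h h₁ h₂ : ℝ → ℂ} {P Q : Polynomial ℂ} {m n : ℕ}

/-- `h t = P t + O(t ^ n)` as the real variable `t` tends to `0`. -/
def HasExpansion (h : ℝ → ℂ) (P : Polynomial ℂ) (n : ℕ) : Prop :=
  (fun t => h t - P.eval (t : ℂ)) =O[𝓝 0] fun t : ℝ => t ^ n

lemma isBigO_pow_of_le (hmn : n ≤ m) : (fun t : ℝ => t ^ m) =O[𝓝 0] fun t => t ^ n := by
  have hbounded : (fun t : ℝ => t ^ (m - n)) =O[𝓝 0] fun _ => (1 : ℝ) :=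
    (continuous_pow (m - n)).continuousAt.isBigO_one ℝ
  simpa only [← pow_add, Nat.sub_add_cancel hmn, one_mul] using
    hbounded.mul (isBigO_refl (fun t : ℝ => t ^ n) _)

lemma isBigO_ofReal_mul (ζ : ℂ) : (fun t : ℝ => (t : ℂ) * ζ) =O[𝓝 0] fun t : ℝ => t :=
  .of_bound ‖ζ‖ (.of_forall fun t => by simp [mul_comm])

lemma isBigO_one_of_eval (P : Polynomial ℂ) :
    (fun t : ℝ => P.eval (t : ℂ)) =O[𝓝 0] fun _ => (1 : ℝ) :=
  (P.continuous.comp continuous_ofReal).continuousAt.isBigO_one ℝ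

lemma isBigO_eval_of_X_pow_dvd (hP : X ^ n ∣ P) :
    (fun t : ℝ => P.eval (t : ℂ)) =O[𝓝 0] fun t => t ^ n := by
  obtain ⟨Q, rfl⟩ := hP
  have hpow : (fun t : ℝ => (t : ℂ) ^ n) =O[𝓝 0] fun t => t ^ n :=
    IsBigO.of_norm_left (by simpa using (isBigO_refl (fun t : ℝ => t ^ n) _).norm_left)
  simpa using hpow.mul (isBigO_one_of_eval Q)

lemma coeff_zero_eq_zero_of_isLittleO
    (hP : (fun t : ℝ => P.eval (t : ℂ)) =o[𝓝[≠] 0] fun t => t ^ n) : P.coeff 0 = 0 := by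
  have hlim : Filter.Tendsto (fun t : ℝ => P.eval (t : ℂ)) (𝓝[≠] 0) (𝓝 (P.eval ((0 : ℝ) : ℂ))) :=
    ((P.continuous.comp continuous_ofReal).tendsto 0).mono_left nhdsWithin_le_nhds
  have hone : (fun t : ℝ => P.eval (t : ℂ)) =o[𝓝[≠] 0] fun _ => (1 : ℝ) :=
    hP.trans_isBigO (((continuous_pow n).continuousAt.isBigO_one ℝ).mono nhdsWithin_le_nhds)
  have := tendsto_nhds_unique hlim ((isLittleO_one_iff ℝ).1 hone)
  rwa [ofReal_zero, ← Polynomial.coeff_zero_eq_eval_zero] at this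

/-- Dividing by `X` lowers both `P` and the order of vanishing by one. -/
lemma coeff_eq_zero_of_isLittleO
    (hP : (fun t : ℝ => P.eval (t : ℂ)) =o[𝓝[≠] 0] fun t => t ^ n) :
    ∀ k ≤ n, P.coeff k = 0 := by
  induction n generalizing P with
  | zero => intro k hk; rw [Nat.le_zero.1 hk]; exact coeff_zero_eq_zero_of_isLittleO hP
  | succ n ih =>
    have hdiv : P = X * P.divX := by
      conv_lhs => rw [← P.divX_mul_X_add, coeff_zero_eq_zero_of_isLittleO hP, map_zero, add_zero,
        mul_comm]
    have hlower : (fun t : ℝ => P.divX.eval (t : ℂ)) =o[𝓝[≠] 0] fun t => t ^ n := by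
      have hinv : (fun t : ℝ => ((t⁻¹ : ℝ) : ℂ)) =O[𝓝[≠] 0] fun t => t⁻¹ :=
        IsBigO.of_norm_left (by simpa using (isBigO_refl (fun t : ℝ => t⁻¹) _).norm_left)
      refine (hinv.mul_isLittleO hP).congr' ?_ ?_
      · filter_upwards [self_mem_nhdsWithin] with t ht
        have ht' : (t : ℂ) ≠ 0 := ofReal_ne_zero.2 ht
        conv_lhs => rw [hdiv, Polynomial.eval_mul, Polynomial.eval_X, ofReal_inv,
          inv_mul_cancel_left₀ ht']
      · filter_upwards [self_mem_nhdsWithin] with t ht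
        rw [pow_succ', inv_mul_cancel_left₀ ht]
    rintro (_ | k) hk
    · exact coeff_zero_eq_zero_of_isLittleO hP
    · rw [← Polynomial.coeff_divX]
      exact ih hlower k (by omega)

lemma isLittleO_pow_of_isBigO_pow_succ (hh : h =O[𝓝 0] fun t : ℝ => t ^ (n + 1)) :
    h =o[𝓝 0] fun t : ℝ => t ^ n :=
  hh.trans_isLittleO (isLittleO_pow_pow n.lt_succ_self)

namespace HasExpansion

lemma mono (hh : HasExpansion h P n) (hmn : m ≤ n) : HasExpansion h P m :=
  IsBigO.trans hh (isBigO_pow_of_le hmn)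

lemma of_isBigO (hh : h =O[𝓝 0] fun t : ℝ => t ^ n) : HasExpansion h 0 n := by
  simpa [HasExpansion] using hh

lemma add (hh₁ : HasExpansion h₁ P n) (hh₂ : HasExpansion h₂ Q n) :
    HasExpansion (fun t => h₁ t + h₂ t) (P + Q) n :=
  (IsBigO.add hh₁ hh₂).congr_left fun t => by rw [Polynomial.eval_add]; ring

lemma sub (hh₁ : HasExpansion h₁ P n) (hh₂ : HasExpansion h₂ Q n) :
    HasExpansion (fun t => h₁ t - h₂ t) (P - Q) n :=
  (IsBigO.sub hh₁ hh₂).congr_left fun t => by rw [Polynomial.eval_sub]; ring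

lemma isBigO_one (hh : HasExpansion h P n) : h =O[𝓝 0] fun _ => (1 : ℝ) := by
  have hrem : (fun t => h t - P.eval (t : ℂ)) =O[𝓝 0] fun _ => (1 : ℝ) := by
    simpa only [HasExpansion, pow_zero] using hh.mono n.zero_le
  simpa only [sub_add_cancel] using hrem.add (isBigO_one_of_eval P)

lemma mul (hh₁ : HasExpansion h₁ P n) (hh₂ : HasExpansion h₂ Q n) :
    HasExpansion (fun t => h₁ t * h₂ t) (P * Q) n := by
  have hleft := IsBigO.mul hh₁ hh₂.isBigO_one
  have hright := (isBigO_one_of_eval P).mul hh₂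
  simp only [mul_one, one_mul] at hleft hright
  exact (hleft.add hright).congr_left fun t => by rw [Polynomial.eval_mul]; ring

lemma map_conj (hh : HasExpansion h P n) :
    HasExpansion (fun t => conj (h t)) (P.map (starRingEnd ℂ)) n := by
  refine IsBigO.of_norm_left ((IsBigO.norm_left hh).congr_left fun t => ?_)
  rw [← norm_conj, map_sub, Polynomial.eval_map, Polynomial.eval, Polynomial.hom_eval₂,
    RingHom.comp_id, conj_ofReal]

lemma of_X_pow_dvd (hh : HasExpansion h P n) (hPQ : X ^ n ∣ P - Q) : HasExpansion h Q n :=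
  (IsBigO.add hh (isBigO_eval_of_X_pow_dvd hPQ)).congr_left fun t => by
    rw [Polynomial.eval_sub]; ring

lemma coeff_eq_zero_of_isBigO (hh : HasExpansion h P n) (hO : h =O[𝓝 0] fun t : ℝ => t ^ n)
    {k : ℕ} (hk : k < n) : P.coeff k = 0 := by
  obtain ⟨n, rfl⟩ : ∃ m, n = m + 1 := ⟨n - 1, by omega⟩
  have hP : (fun t : ℝ => P.eval (t : ℂ)) =O[𝓝 0] fun t => t ^ (n + 1) := by
    simpa using hO.sub hh
  exact coeff_eq_zero_of_isLittleO
    ((isLittleO_pow_of_isBigO_pow_succ hP).mono nhdsWithin_le_nhds) k (by omega)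

lemma isBigO_of_coeff_eq_zero (hh : HasExpansion h P n) (hmn : m ≤ n)
    (hP : ∀ k < m, P.coeff k = 0) : h =O[𝓝 0] fun t : ℝ => t ^ m := by
  have hdvd : X ^ m ∣ P - 0 := by rwa [sub_zero, Polynomial.X_pow_dvd_iff]
  simpa [HasExpansion] using (hh.mono hmn).of_X_pow_dvd hdvd

end HasExpansion

end Expansion

section Polarization

lemma eq_zero_of_forall_ofReal_eq_zero {h : ℂ → ℂ} (hh : Differentiable ℂ h)
    (h0 : ∀ t : ℝ, h t = 0) (z : ℂ) : h z = 0 := by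
  have hreal : Filter.Tendsto (fun t : ℝ => (t : ℂ)) (𝓝[≠] 0) (𝓝[≠] 0) := by
    refine tendsto_nhdsWithin_iff.2 ⟨?_, ?_⟩
    · simpa using (continuous_ofReal.tendsto (0 : ℝ)).mono_left nhdsWithin_le_nhds
    · filter_upwards [self_mem_nhdsWithin] with t ht using ofReal_ne_zero.2 ht
  have hfreq : ∃ᶠ z in 𝓝[≠] (0 : ℂ), h z = 0 :=
    hreal.frequently (Filter.Eventually.of_forall h0).frequently
  exact congr_fun (AnalyticOnNhd.eq_of_frequently_eq (fun w _ => hh.analyticAt w)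
    analyticOnNhd_const hfreq) z

/-- On the real subspace `x, y ∈ ℝ`, the point `(x + i y, x - i y)` runs over the pairs
`(ζ, conj ζ)`; the identity theorem then applies in each variable separately. -/
lemma eq_zero_of_forall_conj_eq_zero {Φ : ℂ × ℂ × ℂ → ℂ} (hΦ : Differentiable ℂ Φ)
    (h0 : ∀ (ζ : ℂ) (s : ℝ), Φ (ζ, conj ζ, s) = 0) (ζ χ s : ℂ) : Φ (ζ, χ, s) = 0 := by
  have hs : ∀ ζ s : ℂ, Φ (ζ, conj ζ, s) = 0 := fun ζ =>
    eq_zero_of_forall_ofReal_eq_zero (by fun_prop) (h0 ζ)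
  have hx : ∀ (y : ℝ) (x : ℂ), Φ (x + I * y, x - I * y, s) = 0 := fun y =>
    eq_zero_of_forall_ofReal_eq_zero (by fun_prop) fun x => by
      simpa [sub_eq_add_neg] using hs (x + I * y) s
  have hy : ∀ x y : ℂ, Φ (x + I * y, x - I * y, s) = 0 := fun x =>
    eq_zero_of_forall_ofReal_eq_zero (by fun_prop) fun y => hx y x
  have hxy := hy ((ζ + χ) / 2) ((ζ - χ) / (2 * I))
  have hI : I * ((ζ - χ) / (2 * I)) = (ζ - χ) / 2 := by field_simp
  rw [hI] at hxy
  convert hxy using 3 <;> ring_nf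

end Polarization

section Taylor

variable {f : ℂ × ℂ → ℂ} {c : ℕ → ℕ → ℂ}

lemma exists_map_diagonal_eq_sum_antidiagonal {R M : Type*} [CommSemiring R] [AddCommMonoid M]
    [Module R M] {n : ℕ} (p : MultilinearMap R (fun _ : Fin n => R × R) M) :
    ∃ b : ℕ → M, ∀ q : R × R,
      p (fun _ => q) = ∑ ij ∈ antidiagonal n, (q.1 ^ ij.1 * q.2 ^ ij.2) • b ij.1 := by
  classical
  refine ⟨fun j => ∑ s ∈ (Finset.univ : Finset (Fin n)).powersetCard j,
    p (s.piecewise (fun _ => (1, 0)) fun _ => (0, 1)), fun q => ?_⟩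
  have hq : (fun _ : Fin n => q) = (fun _ => q.1 • (1, 0)) + fun _ => q.2 • ((0, 1) : R × R) := by
    ext <;> simp
  have hsmul : ∀ s : Finset (Fin n),
      p (s.piecewise (fun _ => q.1 • ((1, 0) : R × R)) fun _ => q.2 • ((0, 1) : R × R)) =
        (q.1 ^ s.card * q.2 ^ (n - s.card)) •
          p (s.piecewise (fun _ => (1, 0)) fun _ => (0, 1)) := by
    intro s
    have hpiecewise :
        (s.piecewise (fun _ => q.1 • ((1, 0) : R × R)) fun _ => q.2 • ((0, 1) : R × R)) =
          fun i => (s.piecewise (fun _ => q.1) fun _ => q.2) i •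
            (s.piecewise (fun _ => ((1, 0) : R × R)) fun _ => (0, 1)) i := by
      funext i
      by_cases hi : i ∈ s <;> simp [hi]
    rw [hpiecewise, p.map_smul_univ, Finset.prod_piecewise]
    simp only [Finset.inter_univ, Finset.univ_inter, Finset.prod_const, Finset.card_sdiff,
      Finset.card_univ, Fintype.card_fin]
  rw [hq, p.map_add_univ, Finset.sum_congr rfl fun s _ => hsmul s, ← Finset.powerset_univ,
    Finset.sum_powerset, Finset.Nat.sum_antidiagonal_eq_sum_range_succ_mk, Finset.card_univ,
    Fintype.card_fin]
  refine Finset.sum_congr rfl fun j _ => ?_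
  rw [Finset.smul_sum]
  exact Finset.sum_congr rfl fun s hs => by rw [(Finset.mem_powersetCard.1 hs).2]

/-- `c i j` is the Taylor coefficient of `z ^ i * w ^ j` at the origin of a function of
`(z, w) ∈ ℂ²`, to every order. -/
def HasTaylorCoeffs (f : ℂ × ℂ → ℂ) (c : ℕ → ℕ → ℂ) : Prop :=
  ∀ N, (fun q => f q -
      ∑ n ∈ range N, ∑ ij ∈ antidiagonal n, c ij.1 ij.2 * q.1 ^ ij.1 * q.2 ^ ij.2)
    =O[𝓝 0] fun q => ‖q‖ ^ N

lemma exists_hasTaylorCoeffs (hf : AnalyticAt ℂ f 0) : ∃ c, HasTaylorCoeffs f c := by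
  obtain ⟨p, hp⟩ := hf
  choose b hb using fun n => exists_map_diagonal_eq_sum_antidiagonal (p n).toMultilinearMap
  refine ⟨fun i j => b (i + j) i, fun N => (hp.isBigO_sub_partialSum_pow N).congr_left fun q => ?_⟩
  rw [zero_add, FormalMultilinearSeries.partialSum]
  congr 1
  refine Finset.sum_congr rfl fun n _ => (hb n q).trans (Finset.sum_congr rfl fun ij hij => ?_)
  rw [← mem_antidiagonal.1 hij, smul_eq_mul]
  ring

lemma HasTaylorCoeffs.apply_zero (hf : HasTaylorCoeffs f c) : f 0 = c 0 0 := by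
  obtain ⟨B, hB⟩ := (hf 1).bound
  have := hB.self_of_nhds
  simpa [sub_eq_zero] using this

lemma HasTaylorCoeffs.hasFDerivAt (hf : HasTaylorCoeffs f c) :
    HasFDerivAt f (c 1 0 • ContinuousLinearMap.fst ℂ ℂ ℂ +
      c 0 1 • ContinuousLinearMap.snd ℂ ℂ ℂ) 0 := by
  refine HasFDerivAt.of_isLittleO ?_
  have hsq : (fun q : ℂ × ℂ => ‖q‖ ^ 2) =o[𝓝 0] fun q => q :=
    isLittleO_norm_right.1
      ((isLittleO_pow_id one_lt_two).comp_tendsto (tendsto_norm_zero (E := ℂ × ℂ)))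
  simpa [Finset.sum_range_succ, Finset.Nat.antidiagonal_succ, hf.apply_zero, sub_sub,
    add_comm, add_left_comm] using (hf 2).trans_isLittleO hsq

end Taylor

section WeightedPart

variable {f : ℂ × ℂ → ℂ} {c : ℕ → ℕ → ℂ}

/-- The component of weight `k` of the power series `∑ c i j * z ^ i * w ^ j` in `q = (z, w)`, for
the weights `[z] = 1` and `[w] = 2`. -/
def weightedPart (c : ℕ → ℕ → ℂ) (k : ℕ) (q : ℂ × ℂ) : ℂ :=
  ∑ l ∈ range (k / 2 + 1), c (k - 2 * l) l * q.1 ^ (k - 2 * l) * q.2 ^ l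

lemma differentiable_weightedPart (c : ℕ → ℕ → ℂ) (k : ℕ) :
    Differentiable ℂ (weightedPart c k) := by
  unfold weightedPart
  fun_prop

lemma conj_weightedPart (c : ℕ → ℕ → ℂ) (k : ℕ) (z w : ℂ) :
    conj (weightedPart c k (z, w)) = weightedPart (fun i j => conj (c i j)) k (conj z, conj w) := by
  simp [weightedPart]

lemma sum_range_sum_antidiagonal_eq_of_weight {M : Type*} [AddCommMonoid M] (a : ℕ → ℕ → M)
    {d N : ℕ} (hd : d < N) :
    ∑ n ∈ range N, ∑ ij ∈ antidiagonal n, (if ij.1 + 2 * ij.2 = d then a ij.1 ij.2 else 0) =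
      ∑ l ∈ range (d / 2 + 1), a (d - 2 * l) l := by
  rw [Finset.sum_sigma', ← Finset.sum_filter]
  refine Finset.sum_nbij' (fun x => x.2.2) (fun l => ⟨d - l, d - 2 * l, l⟩) ?_ ?_ ?_ ?_ ?_
  · rintro ⟨n, i, j⟩ h
    simp only [Finset.mem_filter, Finset.mem_sigma, Finset.mem_range, mem_antidiagonal] at h ⊢
    omega
  · intro l h
    simp only [Finset.mem_filter, Finset.mem_sigma, Finset.mem_range, mem_antidiagonal] at h ⊢
    omega
  · rintro ⟨n, i, j⟩ h
    simp only [Finset.mem_filter, Finset.mem_sigma, Finset.mem_range, mem_antidiagonal] at h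
    obtain ⟨⟨-, rfl⟩, rfl⟩ := h
    congr <;> dsimp only <;> omega
  · intro l _
    rfl
  · rintro ⟨n, i, j⟩ h
    simp only [Finset.mem_filter] at h
    rw [← h.2, Nat.add_sub_cancel]

namespace HasExpansion

variable {w : ℝ → ℂ} {ζ ω ν : ℂ}

lemma eval (P : Polynomial ℂ) (n : ℕ) : HasExpansion (fun t => P.eval (t : ℂ)) P n := by
  simpa [HasExpansion] using isBigO_zero _ _

lemma pow {h : ℝ → ℂ} {P : Polynomial ℂ} {n : ℕ} (hh : HasExpansion h P n) :
    ∀ i : ℕ, HasExpansion (fun t => h t ^ i) (P ^ i) n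
  | 0 => by simpa using eval 1 n
  | i + 1 => by simpa only [pow_succ] using (pow hh i).mul hh

lemma sum {ι : Type*} {s : Finset ι} {h : ι → ℝ → ℂ} {P : ι → Polynomial ℂ} {n : ℕ}
    (hh : ∀ i ∈ s, HasExpansion (h i) (P i) n) :
    HasExpansion (fun t => ∑ i ∈ s, h i t) (∑ i ∈ s, P i) n :=
  (IsBigO.sum hh).congr_left fun t => by
    rw [Polynomial.eval_finsetSum, Finset.sum_apply, Finset.sum_sub_distrib]

/-- The correction `ν * t ^ 5` has weight excess `3`, so below order `6` it is only seen by the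
monomial `w` itself. -/
lemma monomial_comp (hw : HasExpansion w (C ω * X ^ 2 + C ν * X ^ 5) 6) (ζ b : ℂ) (i j : ℕ) :
    HasExpansion (fun t => b * (t * ζ) ^ i * w t ^ j)
      (C (b * ζ ^ i * ω ^ j) * X ^ (i + 2 * j) +
        if i = 0 ∧ j = 1 then C (b * ν) * X ^ 5 else 0) 6 := by
  have hz : HasExpansion (fun t => b * (t * ζ) ^ i) (C b * (X * C ζ) ^ i) 6 := by
    convert eval (C b * (X * C ζ) ^ i) 6 using 2
    rw [Polynomial.eval_mul, Polynomial.eval_pow, Polynomial.eval_mul, Polynomial.eval_X,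
      Polynomial.eval_C, Polynomial.eval_C]
  refine (hz.mul (hw.pow j)).of_X_pow_dvd ?_
  have hsplit : C b * (X * C ζ) ^ i * (C ω * X ^ 2 + C ν * X ^ 5) ^ j =
      C (b * ζ ^ i) * X ^ (i + 2 * j) * (C ω + C ν * X ^ 3) ^ j := by
    rw [show C ω * X ^ 2 + C ν * X ^ 5 = X ^ 2 * (C ω + C ν * X ^ 3) by ring, mul_pow _ _ j,
      C.map_mul, C.map_pow]
    ring
  rw [hsplit]
  rcases eq_or_ne j 0 with rfl | hj
  · simp
  split_ifs with hij
  · obtain ⟨rfl, rfl⟩ := hij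
    convert dvd_zero _ using 1
    simp only [C.map_mul, pow_zero, pow_one, mul_one]
    ring
  · have hcube : (X : Polynomial ℂ) ^ 3 ∣ (C ω + C ν * X ^ 3) ^ j - C ω ^ j :=
      (Dvd.intro_left (C ν) (by ring)).trans (sub_dvd_pow_sub_pow _ _ j)
    have hweight : 6 ≤ i + 2 * j + 3 := by omega
    rw [add_zero, C.map_mul (b * ζ ^ i), C.map_pow ω]
    refine (pow_dvd_pow X hweight).trans ?_
    rw [pow_add]
    convert mul_dvd_mul (dvd_mul_left (X ^ (i + 2 * j)) (C (b * ζ ^ i))) hcube using 1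
    ring

lemma curve_isBigO (hw : HasExpansion w (C ω * X ^ 2 + C ν * X ^ 5) 6) (ζ : ℂ) :
    (fun t : ℝ => ((t * ζ, w t) : ℂ × ℂ)) =O[𝓝 0] fun t : ℝ => t := by
  have hw' := hw.isBigO_of_coeff_eq_zero (m := 1) (by norm_num) fun k hk => by
    obtain rfl : k = 0 := by omega
    simp
  simp only [pow_one] at hw'
  exact (isBigO_ofReal_mul ζ).prod_left hw'

end HasExpansion

/-- The expansion along `t ↦ (t ζ, t² ω + t⁵ ν)` of a function with Taylor coefficients `c`,
truncated at order `6`. -/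
def weightedJet (c : ℕ → ℕ → ℂ) (ζ ω ν : ℂ) : Polynomial ℂ :=
  ∑ k ∈ range 6, C (weightedPart c k (ζ, ω)) * X ^ k + C (c 0 1 * ν) * X ^ 5

lemma coeff_weightedJet (c : ℕ → ℕ → ℂ) (ζ ω ν : ℂ) {k : ℕ} (hk : k < 6) :
    (weightedJet c ζ ω ν).coeff k =
      weightedPart c k (ζ, ω) + if k = 5 then c 0 1 * ν else 0 := by
  simp [weightedJet, Polynomial.finsetSum_coeff, hk, -map_mul]

lemma HasTaylorCoeffs.hasExpansion_comp (hf : HasTaylorCoeffs f c) {w : ℝ → ℂ} {ω ν : ℂ}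
    (hw : HasExpansion w (C ω * X ^ 2 + C ν * X ^ 5) 6) (ζ : ℂ) :
    HasExpansion (fun t => f (t * ζ, w t)) (weightedJet c ζ ω ν) 6 := by
  have hcurve := hw.curve_isBigO ζ
  have htend : Filter.Tendsto (fun t : ℝ => ((t * ζ, w t) : ℂ × ℂ)) (𝓝 0) (𝓝 0) :=
    hcurve.trans_tendsto Filter.tendsto_id
  have hrem : HasExpansion (fun t => f (t * ζ, w t) - ∑ n ∈ range 6, ∑ ij ∈ antidiagonal n,
      c ij.1 ij.2 * (t * ζ) ^ ij.1 * w t ^ ij.2) 0 6 :=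
    .of_isBigO (((hf 6).comp_tendsto htend).trans (hcurve.norm_left.pow 6))
  have hsum := HasExpansion.sum fun n (_ : n ∈ range 6) =>
    HasExpansion.sum fun ij (_ : ij ∈ antidiagonal n) => hw.monomial_comp ζ (c ij.1 ij.2) ij.1 ij.2
  have htotal := hrem.add hsum
  simp only [sub_add_cancel, zero_add] at htotal
  refine htotal.of_X_pow_dvd (Polynomial.X_pow_dvd_iff.2 fun d hd => ?_)
  rw [Polynomial.coeff_sub, coeff_weightedJet c ζ ω ν hd, sub_eq_zero]
  simp only [Polynomial.finsetSum_coeff, Polynomial.coeff_add, Finset.sum_add_distrib,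
    Polynomial.coeff_C_mul_X_pow, eq_comm (a := d)]
  congr 1
  · exact sum_range_sum_antidiagonal_eq_of_weight (fun i j => c i j * ζ ^ i * ω ^ j) hd
  · simp [Finset.sum_range_succ, Finset.Nat.antidiagonal_succ, -map_mul, eq_comm]

end WeightedPart

section PolarizedEquation

variable {a : ℂ} {c d : ℕ → ℕ → ℂ}

/-- The weight components below `6` of the equation `g - conj g = 2 i f * conj f` on the
hypersurface `v = |z|² + 2 Re (a z³ z̄²) + O(6)`, for maps `(f, g)` with Taylor coefficients
`c, d`. The variables `ζ, χ, s` stand for `z, z̄, u`, with `z` and `z̄` made independent. -/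
def PolarizedEquation (a : ℂ) (c d : ℕ → ℕ → ℂ) : Prop :=
  ∀ k < 6, ∀ ζ χ s : ℂ,
    weightedPart d k (ζ, s + I * (ζ * χ)) -
        weightedPart (fun i j => conj (d i j)) k (χ, s - I * (ζ * χ)) +
        (if k = 5 then
          (d 0 1 + conj (d 0 1)) * (I * (a * ζ ^ 3 * χ ^ 2 + conj a * ζ ^ 2 * χ ^ 3)) else 0) =
      2 * I * ∑ ij ∈ antidiagonal k, weightedPart c ij.1 (ζ, s + I * (ζ * χ)) *
        weightedPart (fun i j => conj (c i j)) ij.2 (χ, s - I * (ζ * χ))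

lemma coeffs_eq_zero_of_forall_quintic {p₀ p₁ p₂ p₃ p₄ p₅ : ℂ}
    (h : ∀ x : ℂ, p₀ + p₁ * x + p₂ * x ^ 2 + p₃ * x ^ 3 + p₄ * x ^ 4 + p₅ * x ^ 5 = 0) :
    p₁ = 0 ∧ p₂ = 0 ∧ p₃ = 0 := by
  have hP : C p₀ + C p₁ * X + C p₂ * X ^ 2 + C p₃ * X ^ 3 + C p₄ * X ^ 4 + C p₅ * X ^ 5 = 0 :=
    Polynomial.funext fun x => by simpa using h x
  refine ⟨?_, ?_, ?_⟩
  · simpa [Polynomial.coeff_X, Polynomial.coeff_X_pow] using congr_arg (Polynomial.coeff · 1) hP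
  · simpa [Polynomial.coeff_X, Polynomial.coeff_X_pow] using congr_arg (Polynomial.coeff · 2) hP
  · simpa [Polynomial.coeff_X, Polynomial.coeff_X_pow] using congr_arg (Polynomial.coeff · 3) hP

lemma weightedPart_zero (c : ℕ → ℕ → ℂ) (q : ℂ × ℂ) : weightedPart c 0 q = c 0 0 := by
  simp [weightedPart]

lemma weightedPart_one (c : ℕ → ℕ → ℂ) (q : ℂ × ℂ) : weightedPart c 1 q = c 1 0 * q.1 := by
  simp [weightedPart]

lemma weightedPart_two (c : ℕ → ℕ → ℂ) (q : ℂ × ℂ) :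
    weightedPart c 2 q = c 2 0 * q.1 ^ 2 + c 0 1 * q.2 := by
  simp [weightedPart, Finset.sum_range_succ]

lemma weightedPart_three (c : ℕ → ℕ → ℂ) (q : ℂ × ℂ) :
    weightedPart c 3 q = c 3 0 * q.1 ^ 3 + c 1 1 * q.1 * q.2 := by
  simp [weightedPart, Finset.sum_range_succ]

lemma weightedPart_four (c : ℕ → ℕ → ℂ) (q : ℂ × ℂ) :
    weightedPart c 4 q = c 4 0 * q.1 ^ 4 + c 2 1 * q.1 ^ 2 * q.2 + c 0 2 * q.2 ^ 2 := by
  simp [weightedPart, Finset.sum_range_succ]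

lemma weightedPart_five (c : ℕ → ℕ → ℂ) (q : ℂ × ℂ) :
    weightedPart c 5 q = c 5 0 * q.1 ^ 5 + c 3 1 * q.1 ^ 3 * q.2 + c 1 2 * q.1 * q.2 ^ 2 := by
  simp [weightedPart, Finset.sum_range_succ]

lemma weightedPart_apply_zero_right (c : ℕ → ℕ → ℂ) (k : ℕ) (z : ℂ) :
    weightedPart c k (z, 0) = c k 0 * z ^ k := by
  simp [weightedPart, Finset.sum_range_succ']

namespace PolarizedEquation

lemma apply_one_right (h : PolarizedEquation a c d) {k : ℕ} (hk : k < 6) (x : ℂ) :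
    weightedPart d k (1, 2 * I * x) - conj (d k 0) * x ^ k +
        (if k = 5 then (d 0 1 + conj (d 0 1)) * (I * (a * x ^ 2 + conj a * x ^ 3)) else 0) =
      2 * I * ∑ i ∈ range (k + 1),
        weightedPart c i (1, 2 * I * x) * (conj (c (k - i) 0) * x ^ (k - i)) := by
  have hslice := h k hk 1 x (I * x)
  rw [Finset.Nat.sum_antidiagonal_eq_sum_range_succ_mk] at hslice
  simpa only [one_mul, one_pow, mul_one, sub_self, ← two_mul, ← mul_assoc,
    weightedPart_apply_zero_right] using hslice

variable (h : PolarizedEquation a c d) (hc : c 0 0 = 0)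
include h hc

lemma weight_two : d 0 1 = c 1 0 * conj (c 1 0) := by
  have hslice : ∀ x : ℂ, d 2 0 + (2 * I * (d 0 1 - c 1 0 * conj (c 1 0))) * x +
      (-conj (d 2 0)) * x ^ 2 + 0 * x ^ 3 + 0 * x ^ 4 + 0 * x ^ 5 = 0 := by
    intro x
    have hx : d 2 0 + d 0 1 * (2 * I * x) - conj (d 2 0) * x ^ 2 =
        2 * I * (c 1 0 * (conj (c 1 0) * x)) := by
      simpa [weightedPart_zero, weightedPart_one, weightedPart_two, Finset.sum_range_succ, hc]
        using h.apply_one_right (k := 2) (by norm_num) x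
    linear_combination hx
  have := (coeffs_eq_zero_of_forall_quintic hslice).1
  simpa [sub_eq_zero] using this

lemma weight_three : conj (c 2 0) * c 1 0 = -2 * I * c 0 1 * conj (c 1 0) := by
  have hslice : ∀ x : ℂ, d 3 0 + (2 * I * (d 1 1 - c 2 0 * conj (c 1 0))) * x +
      (-2 * I * (conj (c 2 0) * c 1 0 + 2 * I * c 0 1 * conj (c 1 0))) * x ^ 2 +
      (-conj (d 3 0)) * x ^ 3 + 0 * x ^ 4 + 0 * x ^ 5 = 0 := by
    intro x
    have hx : d 3 0 + d 1 1 * (2 * I * x) - conj (d 3 0) * x ^ 3 =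
        2 * I * (c 1 0 * (conj (c 2 0) * x ^ 2) +
          (c 2 0 + c 0 1 * (2 * I * x)) * (conj (c 1 0) * x)) := by
      simpa [weightedPart_zero, weightedPart_one, weightedPart_two,
        weightedPart_three, Finset.sum_range_succ, hc]
        using h.apply_one_right (k := 3) (by norm_num) x
    linear_combination hx
  have := (coeffs_eq_zero_of_forall_quintic hslice).2.1
  have h2I : (-2 * I : ℂ) ≠ 0 := by simp
  linear_combination (mul_eq_zero.1 this).resolve_left h2I

lemma weight_four :
    c 1 1 * conj (c 1 0) = d 0 2 + I / 2 * (c 2 0 * conj (c 2 0)) ∧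
      conj (c 3 0) * c 1 0 = -2 * I * c 0 1 * conj (c 2 0) := by
  have hslice : ∀ x : ℂ, d 4 0 + (2 * I * (d 2 1 - c 3 0 * conj (c 1 0))) * x +
      (4 * (c 1 1 * conj (c 1 0) - d 0 2 - I / 2 * (c 2 0 * conj (c 2 0)))) * x ^ 2 +
      (-2 * I * (conj (c 3 0) * c 1 0 + 2 * I * c 0 1 * conj (c 2 0))) * x ^ 3 +
      (-conj (d 4 0)) * x ^ 4 + 0 * x ^ 5 = 0 := by
    intro x
    have hx : d 4 0 + d 2 1 * (2 * I * x) + d 0 2 * (2 * I * x) ^ 2 - conj (d 4 0) * x ^ 4 =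
        2 * I * (c 1 0 * (conj (c 3 0) * x ^ 3) +
          (c 2 0 + c 0 1 * (2 * I * x)) * (conj (c 2 0) * x ^ 2) +
          (c 3 0 + c 1 1 * (2 * I * x)) * (conj (c 1 0) * x)) := by
      simpa [weightedPart_zero, weightedPart_one, weightedPart_two,
        weightedPart_three, weightedPart_four, Finset.sum_range_succ, hc]
        using h.apply_one_right (k := 4) (by norm_num) x
    linear_combination hx + (4 * c 1 1 * conj (c 1 0) - 4 * d 0 2) * x ^ 2 * I_sq
  obtain ⟨-, hsq, hcube⟩ := coeffs_eq_zero_of_forall_quintic hslice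
  have h2I : (-2 * I : ℂ) ≠ 0 := by simp
  exact ⟨by linear_combination hsq / 4,
    by linear_combination (mul_eq_zero.1 hcube).resolve_left h2I⟩

lemma weight_four_im : d 0 2 - conj (d 0 2) = 2 * I * (c 0 1 * conj (c 0 1)) := by
  have := h 4 (by norm_num) 0 0 1
  simpa [weightedPart_zero, weightedPart_one, weightedPart_two, weightedPart_three,
    weightedPart_four, Finset.Nat.antidiagonal_succ, hc] using this

lemma weight_five : (d 0 1 + conj (d 0 1)) / 2 * conj a =
    c 2 0 * conj (c 3 0) + 2 * I * (c 1 1 * conj (c 2 0)) - 4 * (c 0 2 * conj (c 1 0)) := by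
  have hslice : ∀ x : ℂ, d 5 0 + (2 * I * (d 3 1 - c 4 0 * conj (c 1 0))) * x +
      (-4 * d 1 2 + (d 0 1 + conj (d 0 1)) * (I * a) -
        2 * I * (c 3 0 * conj (c 2 0) + 2 * I * c 2 1 * conj (c 1 0))) * x ^ 2 +
      (2 * I * ((d 0 1 + conj (d 0 1)) / 2 * conj a -
        (c 2 0 * conj (c 3 0) + 2 * I * (c 1 1 * conj (c 2 0)) -
          4 * (c 0 2 * conj (c 1 0))))) * x ^ 3 +
      (-2 * I * (c 1 0 * conj (c 4 0) + 2 * I * c 0 1 * conj (c 3 0))) * x ^ 4 +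
      (-conj (d 5 0)) * x ^ 5 = 0 := by
    intro x
    have hx : d 5 0 + d 3 1 * (2 * I * x) + d 1 2 * (2 * I * x) ^ 2 - conj (d 5 0) * x ^ 5 +
        (d 0 1 + conj (d 0 1)) * (I * (a * x ^ 2 + conj a * x ^ 3)) =
        2 * I * (c 1 0 * (conj (c 4 0) * x ^ 4) +
          (c 2 0 + c 0 1 * (2 * I * x)) * (conj (c 3 0) * x ^ 3) +
          (c 3 0 + c 1 1 * (2 * I * x)) * (conj (c 2 0) * x ^ 2) +
          (c 4 0 + c 2 1 * (2 * I * x) + c 0 2 * (2 * I * x) ^ 2) * (conj (c 1 0) * x)) := by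
      simpa [weightedPart_zero, weightedPart_one, weightedPart_two,
        weightedPart_three, weightedPart_four, weightedPart_five, Finset.sum_range_succ, hc]
        using h.apply_one_right (k := 5) (by norm_num) x
    linear_combination hx + (-4 * d 1 2 * x ^ 2 + 8 * I * c 0 2 * conj (c 1 0) * x ^ 3) * I_sq
  have h2I : (2 * I : ℂ) ≠ 0 := by simp
  exact sub_eq_zero.1
    ((mul_eq_zero.1 (coeffs_eq_zero_of_forall_quintic hslice).2.2).resolve_left h2I)

/-- The failure of the image of the `u`-axis to be tangent to second order to a complex line is
the minor `c₀₁ d₀₂ - c₀₂ d₀₁`. -/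
lemma conj_mul_eq : conj a * (c 1 0 * conj (c 1 0)) ^ 2 =
    4 * conj (c 1 0) * (c 0 1 * d 0 2 - c 0 2 * d 0 1) := by
  have h₂ := h.weight_two hc
  have h₃ := h.weight_three hc
  obtain ⟨h₄, h₄'⟩ := h.weight_four hc
  have h₅ := h.weight_five hc
  have hreal : conj (d 0 1) = d 0 1 := by rw [h₂, map_mul, conj_conj, mul_comm]
  rw [hreal, h₂] at h₅
  rw [h₂]
  linear_combination (c 1 0 * conj (c 1 0)) * h₅ + c 2 0 * conj (c 1 0) * h₄' +
    2 * I * conj (c 2 0) * c 1 0 * h₄ + (2 * I * d 0 2 - c 2 0 * conj (c 2 0)) * h₃ +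
    (c 2 0 * conj (c 2 0) * conj (c 2 0) * c 1 0 - 4 * d 0 2 * c 0 1 * conj (c 1 0)) * I_sq

end PolarizedEquation

end PolarizedEquation

section MappingEquation

variable {D : Set (ℂ × ℝ)} {F : ℂ × ℝ → ℝ} {a : ℂ} {M : Set (ℂ × ℂ)} {p : ℂ × ℂ}
  {φ : ℂ × ℂ → ℂ × ℂ} {c d : ℕ → ℕ → ℂ} {m n : ℕ}

lemma IsWeightedO6.comp_isBigO {R : ℂ × ℝ → ℝ} (hR : IsWeightedO6 R) {z : ℝ → ℂ} {u : ℝ → ℝ}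
    (hz : z =O[𝓝 0] fun t : ℝ => t) (hu : u =O[𝓝 0] fun t : ℝ => t ^ m) (hm : m ≠ 0)
    (hn : n ≤ 6) (hnm : n ≤ m * 3) :
    (fun t => R (z t, u t)) =O[𝓝 0] fun t : ℝ => t ^ n := by
  have htm : Filter.Tendsto (fun t : ℝ => t ^ m) (𝓝 0) (𝓝 0) := by
    simpa [hm] using (continuous_pow m).tendsto (0 : ℝ)
  have htend : Filter.Tendsto (fun t => (z t, u t)) (𝓝 0) (𝓝 (0 : ℂ × ℝ)) :=
    (hz.trans_tendsto Filter.tendsto_id).prodMk_nhds (hu.trans_tendsto htm)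
  refine (hR.comp_tendsto htend).trans (IsBigO.add ?_ ?_)
  · exact (hz.norm_left.pow 6).trans (isBigO_pow_of_le hn)
  · refine IsBigO.trans ?_ (isBigO_pow_of_le hnm)
    simpa only [← pow_mul, Real.norm_eq_abs] using hu.norm_left.pow 3

lemma IsNormalizingMap.isBigO_comp (hφ : IsNormalizingMap M p φ) {q : ℝ → ℂ × ℂ}
    (hq : Filter.Tendsto q (𝓝 0) (𝓝 p)) (hqM : ∀ᶠ t in 𝓝 0, q t ∈ M)
    (hf : (fun t => (φ (q t)).1) =O[𝓝 0] fun t : ℝ => t)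
    (hg : (fun t => (φ (q t)).2) =O[𝓝 0] fun t : ℝ => t ^ m) (hm : m ≠ 0) (hn : n ≤ 6)
    (hnm : n ≤ m * 3) :
    (fun t => (φ (q t)).2 - conj (φ (q t)).2 - 2 * I * ((φ (q t)).1 * conj (φ (q t)).1))
      =O[𝓝 0] fun t : ℝ => t ^ n := by
  obtain ⟨G, -, hG, hM⟩ := hφ.normalizes
  have hre : (fun t => (φ (q t)).2.re) =O[𝓝 0] fun t : ℝ => t ^ m :=
    (IsBigO.of_bound 1 (.of_forall fun t => by simpa using abs_re_le_norm _)).trans hg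
  have hrem := (hG.comp_isBigO hf hre hm hn hnm)
  refine IsBigO.trans (IsBigO.of_bound 2 ?_) hrem
  filter_upwards [hqM, hq.eventually hM] with t ht htM
  have him := htM.1 ht
  have heq : (φ (q t)).2 - conj (φ (q t)).2 - 2 * I * ((φ (q t)).1 * conj (φ (q t)).1) =
      2 * I * ((G ((φ (q t)).1, (φ (q t)).2.re) - normSq (φ (q t)).1 : ℝ) : ℂ) := by
    rw [sub_conj, mul_conj, him]
    push_cast
    ring
  rw [heq, norm_mul, norm_mul, norm_I, mul_one, Complex.norm_two, Complex.norm_real]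

/-- The model hypersurface `v = |z|² + 2 Re (a z³ z̄²)` to which `F` is compared up to `O(6)`. -/
def modelFive (a z : ℂ) : ℝ :=
  (z * conj z + a * z ^ 3 * conj z ^ 2 + conj a * z ^ 2 * conj z ^ 3).re

lemma modelFive_ofReal_mul (a ζ : ℂ) (t : ℝ) :
    (modelFive a (t * ζ) : ℂ) =
      ζ * conj ζ * t ^ 2 + (a * ζ ^ 3 * conj ζ ^ 2 + conj a * ζ ^ 2 * conj ζ ^ 3) * t ^ 5 := by
  have hreal : conj (ζ * conj ζ * t ^ 2 +
      (a * ζ ^ 3 * conj ζ ^ 2 + conj a * ζ ^ 2 * conj ζ ^ 3) * t ^ 5) =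
      ζ * conj ζ * t ^ 2 + (a * ζ ^ 3 * conj ζ ^ 2 + conj a * ζ ^ 2 * conj ζ ^ 3) * t ^ 5 := by
    simp only [map_add, map_mul, map_pow, conj_conj, conj_ofReal]
    ring
  rw [← conj_eq_iff_re.1 hreal, modelFive, map_mul, conj_ofReal]
  congr 2
  ring

lemma IsWeightedO6.hasExpansion_graphPoint
    (hF : IsWeightedO6 fun m => F m - modelFive a m.1) (ζ : ℂ) (s : ℝ) :
    HasExpansion (fun t => (graphPoint F (t * ζ, t ^ 2 * s)).2)
      (C (s + I * (ζ * conj ζ)) * X ^ 2 +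
        C (I * (a * ζ ^ 3 * conj ζ ^ 2 + conj a * ζ ^ 2 * conj ζ ^ 3)) * X ^ 5) 6 := by
  have hu : (fun t : ℝ => t ^ 2 * s) =O[𝓝 0] fun t : ℝ => t ^ 2 :=
    .of_bound |s| (.of_forall fun t => by simp [mul_comm])
  have hrem := hF.comp_isBigO (n := 6) (isBigO_ofReal_mul ζ) hu two_ne_zero le_rfl le_rfl
  refine (IsBigO.of_bound 1 (.of_forall fun t => le_of_eq ?_)).trans hrem
  have heq : (graphPoint F (t * ζ, t ^ 2 * s)).2 - (C (s + I * (ζ * conj ζ)) * X ^ 2 +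
      C (I * (a * ζ ^ 3 * conj ζ ^ 2 + conj a * ζ ^ 2 * conj ζ ^ 3)) * X ^ 5).eval (t : ℂ) =
      I * ((F (t * ζ, t ^ 2 * s) - modelFive a (t * ζ) : ℝ) : ℂ) := by
    rw [ofReal_sub, modelFive_ofReal_mul]
    simp only [graphPoint, Polynomial.eval_add, Polynomial.eval_mul, Polynomial.eval_C,
      Polynomial.eval_pow, Polynomial.eval_X, ofReal_mul, ofReal_pow]
    ring
  rw [heq, norm_mul, norm_I, Complex.norm_real]

lemma graphPoint_mem_hypersurface {x : ℂ × ℝ} :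
    graphPoint F x ∈ hypersurface D F ↔ x ∈ D := by
  simp [graphPoint, hypersurface]

lemma eventually_graphPoint_mem_hypersurface (hD : D ∈ 𝓝 0) (ζ : ℂ) (s : ℝ) :
    ∀ᶠ t : ℝ in 𝓝 0, graphPoint F (t * ζ, t ^ 2 * s) ∈ hypersurface D F := by
  have hcont : Filter.Tendsto (fun t : ℝ => ((t * ζ, t ^ 2 * s) : ℂ × ℝ)) (𝓝 0) (𝓝 0) :=
    (by fun_prop : Continuous fun t : ℝ => ((t * ζ, t ^ 2 * s) : ℂ × ℝ)).tendsto' _ _ (by simp)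
  exact (hcont.eventually hD).mono fun t ht => graphPoint_mem_hypersurface.2 ht

lemma coeff_weightedJet_mul_map_conj (hc0 : c 0 0 = 0) (ζ ω ν : ℂ) {k : ℕ} (hk : k < 6) :
    (weightedJet c ζ ω ν * (weightedJet c ζ ω ν).map (starRingEnd ℂ)).coeff k =
      ∑ ij ∈ antidiagonal k,
        weightedPart c ij.1 (ζ, ω) * conj (weightedPart c ij.2 (ζ, ω)) := by
  rw [Polynomial.coeff_mul]
  refine Finset.sum_congr rfl fun ij hij => ?_
  have hij' := mem_antidiagonal.1 hij
  have hzero : weightedPart c 0 (ζ, ω) = 0 := by rw [weightedPart_zero, hc0]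
  rw [Polynomial.coeff_map, coeff_weightedJet c ζ ω ν (by omega : ij.1 < 6),
    coeff_weightedJet c ζ ω ν (by omega : ij.2 < 6)]
  rcases eq_or_ne ij.1 5 with h₁ | h₁
  · have h₂ : ij.2 = 0 := by omega
    simp [h₂, hzero]
  rcases eq_or_ne ij.2 5 with h₂ | h₂
  · have h₁ : ij.1 = 0 := by omega
    simp [h₁, hzero]
  simp [h₁, h₂]

namespace IsNormalizingMap

lemma coeff_zero_zero_fst (hφ : IsNormalizingMap M 0 φ)
    (hc : HasTaylorCoeffs (fun q => (φ q).1) c) : c 0 0 = 0 := by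
  rw [← hc.apply_zero, hφ.map_base]; rfl

lemma coeff_zero_zero_snd (hφ : IsNormalizingMap M 0 φ)
    (hd : HasTaylorCoeffs (fun q => (φ q).2) d) : d 0 0 = 0 := by
  rw [← hd.apply_zero, hφ.map_base]; rfl

/-- Along `t ↦ (t ζ, w t)` the second component of `φ` vanishes to order `2` once `d 1 0 = 0`, and
only to order `1` in general; this order `m` limits the order at which the `O(6)` remainder of the
target is seen. -/
lemma mapping_equation (hφ : IsNormalizingMap M 0 φ)
    (hc : HasTaylorCoeffs (fun q => (φ q).1) c) (hd : HasTaylorCoeffs (fun q => (φ q).2) d)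
    {w : ℝ → ℂ} {ζ ω ν : ℂ} (hw : HasExpansion w (C ω * X ^ 2 + C ν * X ^ 5) 6)
    (hM : ∀ᶠ t : ℝ in 𝓝 0, ((t * ζ, w t) : ℂ × ℂ) ∈ M) (hm : m ≠ 0) (hm6 : m ≤ 6) (hn : n ≤ 6)
    (hnm : n ≤ m * 3) (hdm : ∀ k < m, (weightedJet d ζ ω ν).coeff k = 0) {k : ℕ} (hk : k < n) :
    weightedPart d k (ζ, ω) - conj (weightedPart d k (ζ, ω)) +
        (if k = 5 then d 0 1 * ν - conj (d 0 1 * ν) else 0) =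
      2 * I * ∑ ij ∈ antidiagonal k,
        weightedPart c ij.1 (ζ, ω) * conj (weightedPart c ij.2 (ζ, ω)) := by
  have hf := hc.hasExpansion_comp hw ζ
  have hg := hd.hasExpansion_comp hw ζ
  have hc0 := hφ.coeff_zero_zero_fst hc
  have hc1 : ∀ k < 1, (weightedJet c ζ ω ν).coeff k = 0 := fun k hk => by
    obtain rfl : k = 0 := by omega
    simp [coeff_weightedJet, weightedPart_zero, hc0]
  have hfO := hf.isBigO_of_coeff_eq_zero (m := 1) (by norm_num) hc1
  have hgO := hg.isBigO_of_coeff_eq_zero hm6 hdm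
  have hcurve := (hw.curve_isBigO ζ).trans_tendsto Filter.tendsto_id
  simp only [pow_one] at hfO
  have hO := hφ.isBigO_comp hcurve hM hfO hgO hm hn hnm
  have hexp := ((hg.sub hg.map_conj).sub
    ((HasExpansion.eval (C (2 * I)) 6).mul (hf.mul hf.map_conj))).mono hn
  simp only [Polynomial.eval_C] at hexp
  have hcoeff := hexp.coeff_eq_zero_of_isBigO hO hk
  have hk6 : k < 6 := by omega
  rw [Polynomial.coeff_sub, Polynomial.coeff_sub, Polynomial.coeff_C_mul, Polynomial.coeff_map,
    coeff_weightedJet_mul_map_conj hc0 _ _ _ hk6, coeff_weightedJet d ζ ω ν hk6] at hcoeff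
  refine sub_eq_zero.1 (Eq.trans ?_ hcoeff)
  split_ifs <;> simp only [map_add, map_zero] <;> ring

variable (hφ : IsNormalizingMap (hypersurface D F) 0 φ) (hD : D ∈ 𝓝 0)
  (hF : IsWeightedO6 fun m => F m - modelFive a m.1)
  (hc : HasTaylorCoeffs (fun q => (φ q).1) c) (hd : HasTaylorCoeffs (fun q => (φ q).2) d)
include hφ hD hF hc hd

lemma coeff_one_zero_snd : d 1 0 = 0 := by
  have hreal : ∀ ζ : ℂ, d 1 0 * ζ - conj (d 1 0 * ζ) = 0 := fun ζ => by
    have heq := hφ.mapping_equation hc hd (hF.hasExpansion_graphPoint ζ 0)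
      (eventually_graphPoint_mem_hypersurface hD ζ 0) (m := 1) (n := 2) (k := 1) (by norm_num)
      (by norm_num) (by norm_num) (by norm_num) (fun k hk => by
        obtain rfl : k = 0 := by omega
        simp [coeff_weightedJet, weightedPart_zero, hφ.coeff_zero_zero_snd hd]) (by norm_num)
    simpa [weightedPart_zero, weightedPart_one, Finset.Nat.antidiagonal_succ,
      hφ.coeff_zero_zero_fst hc] using heq
  have h1 := hreal 1
  have hI := hreal I
  simp only [map_mul, conj_I, mul_one] at h1 hI
  linear_combination h1 / 2 - I / 2 * hI + (d 1 0 / 2 + conj (d 1 0) / 2) * I_sq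

theorem polarizedEquation : PolarizedEquation a c d := by
  have hd0 := hφ.coeff_zero_zero_snd hd
  have hd1 := hφ.coeff_one_zero_snd hD hF hc hd
  intro k hk ζ χ s
  refine sub_eq_zero.1 (eq_zero_of_forall_conj_eq_zero (Φ := fun x =>
    weightedPart d k (x.1, x.2.2 + I * (x.1 * x.2.1)) -
        weightedPart (fun i j => conj (d i j)) k (x.2.1, x.2.2 - I * (x.1 * x.2.1)) +
        (if k = 5 then (d 0 1 + conj (d 0 1)) *
          (I * (a * x.1 ^ 3 * x.2.1 ^ 2 + conj a * x.1 ^ 2 * x.2.1 ^ 3)) else 0) -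
      2 * I * ∑ ij ∈ antidiagonal k, weightedPart c ij.1 (x.1, x.2.2 + I * (x.1 * x.2.1)) *
        weightedPart (fun i j => conj (c i j)) ij.2 (x.2.1, x.2.2 - I * (x.1 * x.2.1)))
    ?_ (fun ζ s => sub_eq_zero.2 ?_) ζ χ s)
  · have hpart := fun (c : ℕ → ℕ → ℂ) k => differentiable_weightedPart c k
    split_ifs <;> fun_prop
  · have heq := hφ.mapping_equation hc hd (hF.hasExpansion_graphPoint ζ s)
      (eventually_graphPoint_mem_hypersurface hD ζ s) (m := 2) (n := 6) (by norm_num)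
      (by norm_num) le_rfl le_rfl (fun k hk => by
        interval_cases k <;>
          simp [coeff_weightedJet, weightedPart_zero, weightedPart_one, hd0, hd1]) hk
    have hω : conj ((s : ℂ) + I * (ζ * conj ζ)) = s - I * (ζ * conj ζ) := by
      simp only [map_add, map_mul, conj_ofReal, conj_I, conj_conj]
      ring
    simp only [conj_weightedPart, hω] at heq
    rw [← heq]
    congr 1
    refine if_congr Iff.rfl ?_ rfl
    simp only [map_add, map_mul, map_pow, conj_I, conj_conj]
    ring

end IsNormalizingMap

end MappingEquation

section Jets

variable {h : ℝ → ℂ} {P : Polynomial ℂ} {n k : ℕ} {F : ℂ × ℝ → ℝ} {a : ℂ} {f : ℂ × ℂ → ℂ}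
  {φ : ℂ × ℂ → ℂ × ℂ} {c d : ℕ → ℕ → ℂ}

lemma HasExpansion.iteratedDeriv_eq (hh : HasExpansion h P (n + 1)) (hdiff : ContDiffAt ℝ n h 0)
    (hk : k ≤ n) : iteratedDeriv k h 0 = k.factorial * P.coeff k := by
  obtain ⟨s, hs, hdiff⟩ := hdiff.contDiffOn le_rfl (by simp)
  obtain ⟨r, hr, hball⟩ := Metric.mem_nhds_iff.1 hs
  have htaylor := taylor_isLittleO (convex_ball (0 : ℝ) r) (Metric.mem_ball_self hr)
    (hdiff.mono hball)
  rw [nhdsWithin_eq_nhds.2 (Metric.ball_mem_nhds _ hr)] at htaylor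
  set T : Polynomial ℂ := ∑ j ∈ range (n + 1), C ((j.factorial : ℂ)⁻¹ * iteratedDeriv j h 0) * X ^ j
    with hT
  have hdiffPoly : (fun t : ℝ => (P - T).eval (t : ℂ)) =o[𝓝 0] fun t => t ^ n := by
    refine ((htaylor.congr_right fun t => by rw [sub_zero]).sub
      (isLittleO_pow_of_isBigO_pow_succ hh)).congr_left fun t => ?_
    rw [taylor_within_apply, Polynomial.eval_sub, hT, Polynomial.eval_finsetSum]
    have hterm : ∀ j ∈ range (n + 1), ((j.factorial : ℝ)⁻¹ * (t - 0) ^ j) •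
        iteratedDerivWithin j h (Metric.ball 0 r) 0 =
          (C ((j.factorial : ℂ)⁻¹ * iteratedDeriv j h 0) * X ^ j).eval (t : ℂ) := fun j _ => by
      rw [iteratedDerivWithin_of_isOpen Metric.isOpen_ball (Metric.mem_ball_self hr), real_smul]
      simp only [sub_zero, Polynomial.eval_mul, Polynomial.eval_C, Polynomial.eval_pow,
        Polynomial.eval_X]
      push_cast
      ring
    rw [Finset.sum_congr rfl hterm]
    ring
  have hcoeff := coeff_eq_zero_of_isLittleO (hdiffPoly.mono nhdsWithin_le_nhds) k hk
  have hTk : T.coeff k = (k.factorial : ℂ)⁻¹ * iteratedDeriv k h 0 := by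
    simp [hT, Polynomial.finsetSum_coeff, Nat.lt_succ_iff.2 hk, -map_mul]
  rw [Polynomial.coeff_sub, hTk, sub_eq_zero] at hcoeff
  rw [hcoeff, mul_inv_cancel_left₀ (Nat.cast_ne_zero.2 k.factorial_ne_zero)]

lemma iteratedDeriv_clm_comp (L : ℂ →L[ℝ] ℝ) (hdiff : ContDiffAt ℝ n h 0) (hk : k ≤ n) :
    iteratedDeriv k (fun t => L (h t)) 0 = L (iteratedDeriv k h 0) := by
  have := L.iteratedFDeriv_comp_left hdiff (i := k) (mod_cast hk)
  simp only [iteratedDeriv]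
  exact congr_arg (fun p => p fun _ => 1) this

lemma HasExpansion.deriv_clm_comp (L : ℂ →L[ℝ] ℝ) (hh : HasExpansion h P 3)
    (hdiff : ContDiffAt ℝ 2 h 0) :
    deriv (fun t => L (h t)) 0 = L (P.coeff 1) ∧
      deriv (deriv fun t => L (h t)) 0 = 2 * L (P.coeff 2) := by
  constructor
  · simpa [iteratedDeriv_one, hh.iteratedDeriv_eq (n := 2) hdiff one_le_two] using
      iteratedDeriv_clm_comp (k := 1) L (n := 2) hdiff one_le_two
  · have hsmul : L (2 * P.coeff 2) = 2 * L (P.coeff 2) := by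
      rw [← ofReal_ofNat, ← real_smul, map_smul, smul_eq_mul]
    rw [← hsmul]
    simpa [iteratedDeriv_succ, iteratedDeriv_zero, hh.iteratedDeriv_eq (n := 2) hdiff le_rfl] using
      iteratedDeriv_clm_comp (k := 2) L (n := 2) hdiff le_rfl

/-- The jet with derivatives `b`, `2 k` of `z` and `L`, `2 r` of `u` is that of the curve cut out
on `v = |z|²` by a complex line exactly when `k * L = b * (r + i |b|²)`. -/
lemma eq_of_mem_sigmaZero {b k : ℂ} {L r : ℝ} (hL : L ≠ 0)
    (h : (⟨b.re / L, b.im / L, (2 * k.re * L - b.re * (2 * r)) / L ^ 3,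
      (2 * k.im * L - b.im * (2 * r)) / L ^ 3⟩ : Jet2) ∈ sigmaZero) :
    k * L = b * (r + I * normSq b) := by
  obtain ⟨hx, hy⟩ := h
  simp only at hx hy
  field_simp at hx hy
  refine Complex.ext ?_ ?_ <;>
    simp only [mul_re, mul_im, add_re, add_im, ofReal_re, ofReal_im, I_re, I_im, normSq_apply] <;>
    linarith

lemma HasTaylorCoeffs.hasExpansion_axis (hf : HasTaylorCoeffs f c) (hc : c 0 0 = 0) {w : ℝ → ℂ}
    (hw : HasExpansion w X 3) :
    HasExpansion (fun t => f (0, w t)) (C (c 0 1) * X + C (c 0 2) * X ^ 2) 3 := by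
  have hwO : (fun t => ((0, w t) : ℂ × ℂ)) =O[𝓝 0] fun t : ℝ => t := by
    have hw1 := hw.isBigO_of_coeff_eq_zero (m := 1) (by norm_num) fun k hk => by
      obtain rfl : k = 0 := by omega
      simp
    simp only [pow_one] at hw1
    exact (isBigO_zero _ _).prod_left hw1
  have hrem : HasExpansion (fun t => f (0, w t) - (c 0 1 * w t + c 0 2 * w t ^ 2)) 0 3 := by
    refine .of_isBigO (((hf 3).comp_tendsto (hwO.trans_tendsto Filter.tendsto_id)).trans
      (hwO.norm_left.pow 3) |>.congr_left fun t => ?_)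
    simp [Finset.sum_range_succ, Finset.Nat.antidiagonal_succ, hc]
  have hmain := ((HasExpansion.eval (C (c 0 1)) 3).mul hw).add
    ((HasExpansion.eval (C (c 0 2)) 3).mul (hw.pow 2))
  simpa only [Polynomial.eval_C, sub_add_cancel, zero_add] using hrem.add hmain

lemma IsWeightedO6.hasExpansion_axis (hF : IsWeightedO6 fun m => F m - modelFive a m.1) :
    HasExpansion (fun t => (graphPoint F (0, t)).2) X 3 := by
  have hz : (fun _ : ℝ => (0 : ℂ)) =O[𝓝 0] fun t : ℝ => t := isBigO_zero _ _
  have hu : (fun t : ℝ => t) =O[𝓝 0] fun t : ℝ => t ^ 1 := by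
    simpa only [pow_one] using isBigO_refl (fun t : ℝ => t) _
  have hrem := hF.comp_isBigO (n := 3) hz hu one_ne_zero (by norm_num) le_rfl
  refine (IsBigO.of_bound 1 (.of_forall fun t => ?_)).trans hrem
  simp [graphPoint, modelFive]

lemma IsWeightedO6.apply_zero (hF : IsWeightedO6 fun m => F m - modelFive a m.1) : F 0 = 0 := by
  obtain ⟨B, hB⟩ := hF.bound
  simpa [modelFive] using hB.self_of_nhds

lemma contDiffAt_snd_graphPoint_axis (hF : ContDiffAt ℝ 2 F 0) :
    ContDiffAt ℝ 2 (fun t : ℝ => (graphPoint F (0, t)).2) 0 := by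
  have hFaxis : ContDiffAt ℝ 2 (fun t : ℝ => F (0, t)) 0 :=
    ContDiffAt.comp (g := F) 0 hF (by fun_prop)
  exact ofRealCLM.contDiff.contDiffAt.add
    (contDiffAt_const.mul (ofRealCLM.contDiff.contDiffAt.comp 0 hFaxis))

/-- The chain condition for the `u`-axis: the 2-jet of its image is proportional to its value, so
the image is tangent to second order to a complex line. -/
lemma mul_eq_mul_of_prolong2_mem_sigmaZero
    (hF : IsWeightedO6 fun m => F m - modelFive a m.1) (hFdiff : ContDiffAt ℝ 2 F 0)
    (hφ : AnalyticAt ℂ φ 0) (hc : HasTaylorCoeffs (fun q => (φ q).1) c)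
    (hd : HasTaylorCoeffs (fun q => (φ q).2) d) (hc0 : c 0 0 = 0) (hd0 : d 0 0 = 0)
    (hd1 : (d 0 1).re ≠ 0) (hj : prolong2 φ F 0 ⟨0, 0, 0, 0⟩ ∈ sigmaZero) :
    c 0 2 * (d 0 1).re = c 0 1 * ((d 0 2).re + I * normSq (c 0 1)) := by
  have hrep : representative F 0 ⟨0, 0, 0, 0⟩ = fun t => (0, (graphPoint F (0, t)).2) := by
    funext t
    simp [representative, graphPoint]
  have hU : imageU φ F 0 ⟨0, 0, 0, 0⟩ = fun t => (φ (0, (graphPoint F (0, t)).2)).2.re := by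
    funext t
    rw [imageU, hrep]
  have haxis : ContDiffAt ℝ 2 (fun t : ℝ => φ (0, (graphPoint F (0, t)).2)) 0 := by
    refine ContDiffAt.comp (g := φ) 0 ?_
      (contDiffAt_const.prodMk (contDiffAt_snd_graphPoint_axis hFdiff))
    have hbase : ((0 : ℂ), (graphPoint F (0, 0)).2) = 0 := by
      simp [graphPoint, ← Prod.zero_eq_mk, hF.apply_zero]
    rw [hbase]
    exact hφ.contDiffAt.restrict_scalars ℝ
  have hfst := hc.hasExpansion_axis hc0 hF.hasExpansion_axis
  have hsnd := hd.hasExpansion_axis hd0 hF.hasExpansion_axis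
  obtain ⟨hX₁, hX₂⟩ := hfst.deriv_clm_comp reCLM (contDiffAt_fst.comp 0 haxis)
  obtain ⟨hY₁, hY₂⟩ := hfst.deriv_clm_comp imCLM (contDiffAt_fst.comp 0 haxis)
  obtain ⟨hU₁, hU₂⟩ := hsnd.deriv_clm_comp reCLM (contDiffAt_snd.comp 0 haxis)
  have hcoeff : ∀ α β : ℂ, (C α * X + C β * X ^ 2).coeff 1 = α ∧
      (C α * X + C β * X ^ 2).coeff 2 = β := fun α β => by
    simp
  simp only [(hcoeff _ _).1, (hcoeff _ _).2, reCLM_apply, imCLM_apply]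
    at hX₁ hX₂ hY₁ hY₂ hU₁ hU₂
  refine eq_of_mem_sigmaZero hd1 ?_
  simpa only [prolong2, jetOfCurve, hU, hrep, hX₁, hX₂, hY₁, hY₂, hU₁, hU₂] using hj

end Jets

section Translation

variable {M : Set (ℂ × ℂ)} {p : ℂ × ℂ} {φ : ℂ × ℂ → ℂ × ℂ}

lemma IsNormalizingMap.comp_add_left (v : ℂ × ℂ) (hφ : IsNormalizingMap M (v + p) φ) :
    IsNormalizingMap ((v + ·) ⁻¹' M) p fun q => φ (v + q) where
  analyticAt := hφ.analyticAt.comp_of_eq (analyticAt_const.add analyticAt_id) rfl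
  map_base := hφ.map_base
  invertible := by
    rw [fderiv_comp_add_left]
    exact hφ.invertible
  normalizes := by
    obtain ⟨G, hG, hG6, hM⟩ := hφ.normalizes
    have htend : Filter.Tendsto (v + ·) (𝓝 p) (𝓝 (v + p)) := (continuous_const_add v).tendsto p
    exact ⟨G, hG, hG6, htend.eventually hM⟩

variable (D : Set (ℂ × ℝ)) (F : ℂ × ℝ → ℝ) (m₀ m : ℂ × ℝ)

lemma preimage_add_left_hypersurface :
    (((m₀.1, (m₀.2 : ℂ)) : ℂ × ℂ) + ·) ⁻¹' hypersurface D F =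
      hypersurface ((m₀ + ·) ⁻¹' D) fun m => F (m₀ + m) := by
  ext q
  simp [hypersurface, Prod.add_def]

lemma graphPoint_add :
    graphPoint F (m₀ + m) = (m₀.1, (m₀.2 : ℂ)) + graphPoint (fun m => F (m₀ + m)) m := by
  simp [graphPoint, add_assoc]

lemma representative_add (j : Jet2) (t : ℝ) :
    representative F (m₀ + m) j t =
      (m₀.1, (m₀.2 : ℂ)) + representative (fun m => F (m₀ + m)) m j t := by
  rw [representative, representative, ← graphPoint_add]
  congr 1
  ext1 <;> simp only [Prod.fst_add, Prod.snd_add] <;> ring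

lemma imageU_add (j : Jet2) :
    imageU φ F (m₀ + m) j =
      imageU (fun q => φ ((m₀.1, (m₀.2 : ℂ)) + q)) (fun m => F (m₀ + m)) m j := by
  funext t
  rw [imageU, imageU, representative_add]

lemma chainLocus_add_subset :
    chainLocus D F (m₀ + m) ⊆ chainLocus ((m₀ + ·) ⁻¹' D) (fun m => F (m₀ + m)) m := by
  rintro j ⟨φ, hφ, hU, hj⟩
  rw [graphPoint_add] at hφ
  refine ⟨_, preimage_add_left_hypersurface D F m₀ ▸ hφ.comp_add_left _, ?_, ?_⟩
  · rwa [imageU_add] at hU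
  · simpa only [prolong2, imageU_add, representative_add] using hj

end Translation

section Obstruction

variable {D : Set (ℂ × ℝ)} {F : ℂ × ℝ → ℝ} {a : ℂ} {φ : ℂ × ℂ → ℂ × ℂ} {c d : ℕ → ℕ → ℂ}

lemma coeff_one_zero_fst_ne_zero (hφ : DifferentiableAt ℂ φ 0)
    (hinv : (fderiv ℂ φ 0).IsInvertible)
    (hc : HasTaylorCoeffs (fun q => (φ q).1) c) (hd : HasTaylorCoeffs (fun q => (φ q).2) d)
    (hd1 : d 1 0 = 0) : c 1 0 ≠ 0 := by
  intro hc1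
  have hzero : fderiv ℂ φ 0 (1, 0) = 0 := by
    ext1
    · simpa [hc1] using congr_arg (fun L => L (1, 0))
        (hφ.hasFDerivAt.fst.unique hc.hasFDerivAt)
    · simpa [hd1] using congr_arg (fun L => L (1, 0))
        (hφ.hasFDerivAt.snd.unique hd.hasFDerivAt)
  have := hinv.injective (hzero.trans (map_zero _).symm)
  simp at this

lemma eq_zero_of_mem_chainLocus_zero (hD : D ∈ 𝓝 0) (hFdiff : ContDiffAt ℝ 2 F 0)
    (hF : IsWeightedO6 fun m => F m - modelFive a m.1)
    (hj : (⟨0, 0, 0, 0⟩ : Jet2) ∈ chainLocus D F 0) : a = 0 := by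
  obtain ⟨φ, hφ, -, hj⟩ := hj
  have hbase : graphPoint F 0 = 0 := by simp [graphPoint, hF.apply_zero]
  rw [hbase] at hφ
  obtain ⟨c, hc⟩ := exists_hasTaylorCoeffs (analyticAt_fst.comp hφ.analyticAt)
  obtain ⟨d, hd⟩ := exists_hasTaylorCoeffs (analyticAt_snd.comp hφ.analyticAt)
  have hc0 := hφ.coeff_zero_zero_fst hc
  have hc1 : c 1 0 ≠ 0 := coeff_one_zero_fst_ne_zero hφ.analyticAt.differentiableAt
    hφ.invertible hc hd (hφ.coeff_one_zero_snd hD hF hc hd)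
  have heq := hφ.polarizedEquation hD hF hc hd
  have hd01 : d 0 1 = normSq (c 1 0) := by rw [heq.weight_two hc0, mul_conj]
  have hd02 : d 0 2 = (d 0 2).re + I * normSq (c 0 1) := by
    have him := heq.weight_four_im hc0
    rw [sub_conj, mul_conj, ofReal_mul, ofReal_ofNat] at him
    conv_lhs => rw [← re_add_im (d 0 2)]
    linear_combination him / 2
  have hchain : c 0 2 * d 0 1 = c 0 1 * d 0 2 := by
    have := mul_eq_mul_of_prolong2_mem_sigmaZero hF hFdiff hφ.analyticAt hc hd hc0
      (hφ.coeff_zero_zero_snd hd) (by simpa [hd01] using hc1) hj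
    rwa [← hd02, hd01, ofReal_re, ← hd01] at this
  have hmain := heq.conj_mul_eq hc0
  rw [← hchain] at hmain
  simpa [hc1] using hmain

theorem eq_zero_of_mem_chainLocus {m₀ : ℂ × ℝ} (hD : D ∈ 𝓝 m₀) (hFdiff : ContDiffAt ℝ 2 F m₀)
    (hF : IsWeightedO6 fun m => F (m₀ + m) - modelFive a m.1)
    (hj : (⟨0, 0, 0, 0⟩ : Jet2) ∈ chainLocus D F m₀) : a = 0 := by
  have hshift : Filter.Tendsto (m₀ + ·) (𝓝 0) (𝓝 m₀) :=
    (continuous_const_add m₀).tendsto' _ _ (add_zero m₀)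
  have hFdiff' : ContDiffAt ℝ 2 (fun m => F (m₀ + m)) 0 :=
    ContDiffAt.comp (g := F) 0 (by rwa [add_zero]) (by fun_prop)
  rw [← add_zero m₀] at hj
  exact eq_zero_of_mem_chainLocus_zero (hshift hD) hFdiff' hF (chainLocus_add_subset D F m₀ 0 hj)

end Obstruction

section Wirtinger

variable {D : Set (ℂ × ℝ)} {H : ℂ × ℝ → ℂ} {n : ℕ}

lemma contDiffOn_fderiv_apply (hD : IsOpen D) (hH : ContDiffOn ℝ (n + 1) H D) (v : ℂ × ℝ) :
    ContDiffOn ℝ n (fun m => fderiv ℝ H m v) D :=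
  (hH.fderiv_of_isOpen hD le_rfl).clm_apply contDiffOn_const

lemma contDiffOn_dz (hD : IsOpen D) (hH : ContDiffOn ℝ (n + 1) H D) : ContDiffOn ℝ n (dz H) D :=
  contDiffOn_const.mul ((contDiffOn_fderiv_apply hD hH _).sub
    (contDiffOn_const.mul (contDiffOn_fderiv_apply hD hH _)))

lemma contDiffOn_dzbar (hD : IsOpen D) (hH : ContDiffOn ℝ (n + 1) H D) :
    ContDiffOn ℝ n (dzbar H) D :=
  contDiffOn_const.mul ((contDiffOn_fderiv_apply hD hH _).add
    (contDiffOn_const.mul (contDiffOn_fderiv_apply hD hH _)))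

lemma contDiffOn_iterate {T : (ℂ × ℝ → ℂ) → ℂ × ℝ → ℂ}
    (hT : ∀ {n : ℕ} {H}, ContDiffOn ℝ (n + 1) H D → ContDiffOn ℝ n (T H) D) {k : ℕ}
    (hH : ContDiffOn ℝ (n + k : ℕ) H D) : ContDiffOn ℝ n (T^[k] H) D := by
  induction k generalizing H with
  | zero => exact hH
  | succ k ih => exact ih (hT (mod_cast hH))

lemma contDiffOn_iterate_dzbar (hD : IsOpen D) {k : ℕ} (hH : ContDiffOn ℝ (n + k : ℕ) H D) :
    ContDiffOn ℝ n (dzbar^[k] H) D :=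
  contDiffOn_iterate (contDiffOn_dzbar hD) hH

lemma contDiffOn_iterate_dzbar_iterate_dz (hD : IsOpen D) {j k : ℕ}
    (hH : ContDiffOn ℝ (n + (j + k) : ℕ) H D) : ContDiffOn ℝ n (dzbar^[k] (dz^[j] H)) D :=
  contDiffOn_iterate_dzbar hD (contDiffOn_iterate (contDiffOn_dz hD)
    (by rwa [add_assoc, add_comm k]))

lemma dzbar_congr (hD : IsOpen D) {H₁ H₂ : ℂ × ℝ → ℂ} (h : Set.EqOn H₁ H₂ D) :
    Set.EqOn (dzbar H₁) (dzbar H₂) D := fun m hm => by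
  simp only [dzbar, (Filter.eventuallyEq_of_mem (hD.mem_nhds hm) h).fderiv_eq]

lemma dz_congr (hD : IsOpen D) {H₁ H₂ : ℂ × ℝ → ℂ} (h : Set.EqOn H₁ H₂ D) :
    Set.EqOn (dz H₁) (dz H₂) D := fun m hm => by
  simp only [dz, (Filter.eventuallyEq_of_mem (hD.mem_nhds hm) h).fderiv_eq]

lemma dz_dzbar_comm {m : ℂ × ℝ} (hH : ContDiffAt ℝ 2 H m) : dz (dzbar H) m = dzbar (dz H) m := by
  have hsymm : IsSymmSndFDerivAt ℝ H m := hH.isSymmSndFDerivAt (by simp)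
  have hdiff : DifferentiableAt ℝ (fderiv ℝ H) m :=
    (hH.fderiv_right (m := 1) (by norm_num)).differentiableAt one_ne_zero
  have hv : ∀ v : ℂ × ℝ, HasFDerivAt (fun m => fderiv ℝ H m v)
      ((fderiv ℝ (fderiv ℝ H) m).flip v) m := fun v => by
    simpa using hdiff.hasFDerivAt.clm_apply (hasFDerivAt_const v m)
  have hdzbar : HasFDerivAt (dzbar H) ((1 / 2 : ℂ) • ((fderiv ℝ (fderiv ℝ H) m).flip (1, 0) +
      I • (fderiv ℝ (fderiv ℝ H) m).flip (I, 0))) m :=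
    ((hv _).fun_add ((hv _).const_mul I)).const_mul _
  have hdz : HasFDerivAt (dz H) ((1 / 2 : ℂ) • ((fderiv ℝ (fderiv ℝ H) m).flip (1, 0) -
      I • (fderiv ℝ (fderiv ℝ H) m).flip (I, 0))) m :=
    ((hv _).fun_sub ((hv _).const_mul I)).const_mul _
  rw [dz, dzbar, hdzbar.fderiv, hdz.fderiv]
  simp only [smul_apply, add_apply, sub_apply, ContinuousLinearMap.flip_apply, smul_eq_mul]
  rw [hsymm.eq (I, 0) (1, 0)]
  ring

lemma dz_iterate_dzbar_comm (hD : IsOpen D) {k : ℕ} (hH : ContDiffOn ℝ (k + 1) H D) :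
    Set.EqOn (dz (dzbar^[k] H)) (dzbar^[k] (dz H)) D := by
  induction k with
  | zero => exact fun _ _ => rfl
  | succ k ih =>
    rw [Function.iterate_succ_apply', Function.iterate_succ_apply']
    have hcomm : Set.EqOn (dz (dzbar (dzbar^[k] H))) (dzbar (dz (dzbar^[k] H))) D := fun m hm =>
      dz_dzbar_comm (((contDiffOn_iterate_dzbar (n := 2) hD (hH.of_le
        (by norm_cast; omega))).contDiffAt (hD.mem_nhds hm)))
    exact hcomm.trans (dzbar_congr hD (ih (hH.of_le (by norm_cast; omega))))

lemma iterate_dz_iterate_dzbar_comm (hD : IsOpen D) {j k : ℕ}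
    (hH : ContDiffOn ℝ (j + k : ℕ) H D) :
    Set.EqOn (dz^[j] (dzbar^[k] H)) (dzbar^[k] (dz^[j] H)) D := by
  induction j with
  | zero => exact fun _ _ => rfl
  | succ j ih =>
    rw [Function.iterate_succ_apply', Function.iterate_succ_apply']
    refine (dz_congr hD (ih (hH.of_le (by norm_cast; omega)))).trans
      (dz_iterate_dzbar_comm hD ?_)
    exact contDiffOn_iterate (n := k + 1) (contDiffOn_dz hD) (hH.of_le (by norm_cast; omega))

lemma conj_dz (H : ℂ × ℝ → ℂ) : (fun m => conj (dz H m)) = dzbar fun m => conj (H m) := by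
  funext m
  have hconj : fderiv ℝ (fun m => conj (H m)) m =
      (conjCLE : ℂ →L[ℝ] ℂ).comp (fderiv ℝ H m) := conjCLE.comp_fderiv
  simp [dz, dzbar, hconj, map_ofNat]

lemma conj_dzbar (H : ℂ × ℝ → ℂ) : (fun m => conj (dzbar H m)) = dz fun m => conj (H m) := by
  funext m
  have hconj := congr_fun (conj_dz fun m => conj (H m)) m
  simp only [conj_conj] at hconj
  rw [← hconj, conj_conj]

lemma conj_iterate {S T : (ℂ × ℝ → ℂ) → ℂ × ℝ → ℂ}
    (hST : ∀ H, (fun m => conj (S H m)) = T fun m => conj (H m)) (k : ℕ) (H : ℂ × ℝ → ℂ) :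
    (fun m => conj ((S^[k] H) m)) = T^[k] fun m => conj (H m) := by
  induction k generalizing H with
  | zero => rfl
  | succ k ih => rw [Function.iterate_succ_apply, Function.iterate_succ_apply, ih, hST]

lemma conj_coeff (hD : IsOpen D) {F : ℂ × ℝ → ℝ} {j k : ℕ}
    (hF : ContDiffOn ℝ (j + k : ℕ) F D) {u : ℝ} (hu : ((0 : ℂ), u) ∈ D) :
    conj (coeff F j k u) = coeff F k j u := by
  have hFC : ContDiffOn ℝ (k + j : ℕ) (fun m => (F m : ℂ)) D :=
    ofRealCLM.contDiff.comp_contDiffOn (add_comm j k ▸ hF)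
  have hconj := congr_fun (conj_iterate conj_dzbar k (dz^[j] fun m => (F m : ℂ))) (0, u)
  rw [conj_iterate conj_dz] at hconj
  simp only [conj_ofReal] at hconj
  rw [coeff, coeff, map_div₀, hconj, iterate_dz_iterate_dzbar_comm hD hFC hu, map_mul,
    map_natCast, map_natCast, mul_comm (j.factorial : ℂ)]

lemma fderiv_apply_eq_wirtinger (H : ℂ × ℝ → ℂ) (m : ℂ × ℝ) (z : ℂ) :
    fderiv ℝ H m (z, 0) = z * dz H m + conj z * dzbar H m := by
  have hbasis : ((z, 0) : ℂ × ℝ) = z.re • (1, 0) + z.im • (I, 0) := by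
    ext <;> simp
  have hz : z = z.re + z.im * I := (re_add_im z).symm
  have hz' : conj z = z.re - z.im * I := by apply Complex.ext <;> simp
  rw [hbasis, map_add, map_smul, map_smul, hz', dz, dzbar, real_smul, real_smul]
  linear_combination ((z.im : ℂ) * fderiv ℝ H m (I, 0)) * I_sq -
    (1 / 2 : ℂ) * (fderiv ℝ H m (1, 0) - I * fderiv ℝ H m (I, 0)) * hz

end Wirtinger

section WirtingerTaylor

variable {D : Set (ℂ × ℝ)} {H : ℂ × ℝ → ℂ} {n : ℕ}

/-- The `n`-th derivative of `H` in the direction `(z, 0)`, in terms of Wirtinger derivatives. -/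
def dirDeriv (H : ℂ × ℝ → ℂ) (n : ℕ) (z : ℂ) (m : ℂ × ℝ) : ℂ :=
  ∑ ij ∈ antidiagonal n,
    (n.choose ij.1 : ℂ) * (z ^ ij.1 * conj z ^ ij.2 * (dzbar^[ij.2] (dz^[ij.1] H)) m)

lemma hasFDerivAt_dirDeriv (hD : IsOpen D) (hH : ContDiffOn ℝ (n + 1) H D) (z : ℂ)
    {m : ℂ × ℝ} (hm : m ∈ D) :
    HasFDerivAt (dirDeriv H n z) (∑ ij ∈ antidiagonal n, (n.choose ij.1 : ℂ) •
      ((z ^ ij.1 * conj z ^ ij.2) • fderiv ℝ (dzbar^[ij.2] (dz^[ij.1] H)) m)) m := by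
  refine HasFDerivAt.fun_sum fun ij hij => (HasFDerivAt.const_mul ?_ _).const_mul _
  have hmix : ContDiffOn ℝ (1 : ℕ) (dzbar^[ij.2] (dz^[ij.1] H)) D :=
    contDiffOn_iterate_dzbar_iterate_dz hD
      (by rwa [mem_antidiagonal.1 hij, add_comm 1, Nat.cast_add, Nat.cast_one])
  exact ((hmix.contDiffAt (hD.mem_nhds hm)).differentiableAt (by norm_num)).hasFDerivAt

lemma fderiv_dirDeriv (hD : IsOpen D) (hH : ContDiffOn ℝ (n + 1) H D) (z : ℂ)
    {m : ℂ × ℝ} (hm : m ∈ D) :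
    fderiv ℝ (dirDeriv H n z) m (z, 0) = dirDeriv H (n + 1) z m := by
  rw [(hasFDerivAt_dirDeriv hD hH z hm).fderiv, dirDeriv, Finset.sum_antidiagonal_choose_succ_mul
    (fun i j => z ^ i * conj z ^ j * (dzbar^[j] (dz^[i] H)) m) n, sum_apply,
    ← Finset.sum_add_distrib]
  refine Finset.sum_congr rfl fun ij hij => ?_
  have hchoose : n.choose ij.2 = n.choose ij.1 := by
    rw [← mem_antidiagonal.1 hij, add_comm]
    exact Nat.choose_symm_add
  have hcomm : dz (dzbar^[ij.2] (dz^[ij.1] H)) m = (dzbar^[ij.2] (dz^[ij.1 + 1] H)) m := by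
    rw [Function.iterate_succ_apply']
    refine dz_iterate_dzbar_comm hD ?_ hm
    refine contDiffOn_iterate (n := ij.2 + 1) (contDiffOn_dz hD) ?_
    rwa [add_right_comm, add_comm ij.2, mem_antidiagonal.1 hij]
  rw [hchoose, smul_apply, smul_apply, fderiv_apply_eq_wirtinger, hcomm,
    ← Function.iterate_succ_apply' dzbar]
  simp only [smul_eq_mul]
  ring

lemma hasDerivAt_dirDeriv (hD : IsOpen D) (hH : ContDiffOn ℝ (n + 1) H D) (z : ℂ) (u t : ℝ)
    (hm : ((t : ℂ) * z, u) ∈ D) :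
    HasDerivAt (fun t : ℝ => dirDeriv H n z ((t : ℂ) * z, u))
      (dirDeriv H (n + 1) z (t * z, u)) t := by
  have hray : HasDerivAt (fun t : ℝ => ((t : ℂ) * z, u)) (z, 0) t :=
    .prodMk (by simpa using (ofRealCLM.hasDerivAt (x := t)).mul_const z) (hasDerivAt_const _ _)
  rw [← fderiv_dirDeriv hD hH z hm]
  exact (hasFDerivAt_dirDeriv hD hH z hm).differentiableAt.hasFDerivAt.comp_hasDerivAt t hray

lemma iteratedDerivWithin_ray (hD : IsOpen D) (hH : ContDiffOn ℝ n H D) {z : ℂ} {u : ℝ}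
    (hm : ∀ t ∈ Set.Icc (0 : ℝ) 1, ((t : ℂ) * z, u) ∈ D) {t : ℝ} (ht : t ∈ Set.Icc (0 : ℝ) 1) :
    iteratedDerivWithin n (fun t : ℝ => H ((t : ℂ) * z, u)) (Set.Icc 0 1) t =
      dirDeriv H n z (t * z, u) := by
  induction n generalizing t with
  | zero => simp [dirDeriv]
  | succ n ih =>
    rw [iteratedDerivWithin_succ,
      derivWithin_congr (fun s hs => ih (hH.of_le (by norm_cast; omega)) hs)
        (ih (hH.of_le (by norm_cast; omega)) ht)]
    exact (hasDerivAt_dirDeriv hD hH z u t (hm t ht)).hasDerivWithinAt.derivWithin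
      (uniqueDiffOn_Icc zero_lt_one t ht)

lemma norm_sub_taylor_le (hD : IsOpen D) (hH : ContDiffOn ℝ (n + 1) H D) {z : ℂ} {u : ℝ}
    (hm : ∀ t ∈ Set.Icc (0 : ℝ) 1, ((t : ℂ) * z, u) ∈ D) {B : ℝ}
    (hB : ∀ t ∈ Set.Icc (0 : ℝ) 1, ‖dirDeriv H (n + 1) z (t * z, u)‖ ≤ B) :
    ‖H (z, u) - ∑ k ∈ range (n + 1), (k.factorial : ℂ)⁻¹ * dirDeriv H k z (0, u)‖ ≤ B := by
  have hray : ContDiff ℝ (n + 1) fun t : ℝ => ((t : ℂ) * z, u) :=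
    (ofRealCLM.contDiff.mul contDiff_const).prodMk contDiff_const
  have hcd : ContDiffOn ℝ (n + 1) (fun t : ℝ => H ((t : ℂ) * z, u)) (Set.Icc 0 1) :=
    hH.comp hray.contDiffOn hm
  have htaylor := taylor_mean_remainder_bound zero_le_one hcd (Set.right_mem_Icc.2 zero_le_one)
    fun t ht => (iteratedDerivWithin_ray hD hH hm ht).symm ▸ hB t ht
  have hsum : taylorWithinEval (fun t : ℝ => H ((t : ℂ) * z, u)) n (Set.Icc 0 1) 0 1 =
      ∑ k ∈ range (n + 1), (k.factorial : ℂ)⁻¹ * dirDeriv H k z (0, u) := by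
    rw [taylor_within_apply]
    refine Finset.sum_congr rfl fun k hk => ?_
    rw [iteratedDerivWithin_ray hD (hH.of_le (by norm_cast; exact (Finset.mem_range.1 hk).le)) hm
      (Set.left_mem_Icc.2 zero_le_one)]
    simp
  rw [hsum] at htaylor
  simp only [ofReal_one, one_mul, sub_zero, one_pow, mul_one] at htaylor
  have hB0 : 0 ≤ B := (norm_nonneg _).trans (hB 0 (by simp))
  exact htaylor.trans (div_le_self hB0 (Nat.one_le_cast.2 n.factorial_pos))

lemma eventually_norm_dirDeriv_le (hD : IsOpen D) (hH : ContDiffOn ℝ n H D) {m₀ : ℂ × ℝ}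
    (hm₀ : m₀ ∈ D) : ∃ B : ℝ, ∀ᶠ m in 𝓝 m₀, ∀ z : ℂ, ‖dirDeriv H n z m‖ ≤ B * ‖z‖ ^ n := by
  have hbounded : ∀ ij ∈ antidiagonal n, ∀ᶠ m in 𝓝 m₀,
      ‖(dzbar^[ij.2] (dz^[ij.1] H)) m‖ < ‖(dzbar^[ij.2] (dz^[ij.1] H)) m₀‖ + 1 := fun ij hij => by
    have hmix : ContDiffOn ℝ (0 : ℕ) (dzbar^[ij.2] (dz^[ij.1] H)) D :=
      contDiffOn_iterate_dzbar_iterate_dz hD (by rwa [mem_antidiagonal.1 hij, zero_add])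
    exact (hmix.continuousOn.continuousAt (hD.mem_nhds hm₀)).norm.eventually_lt_const
      (lt_add_one _)
  refine ⟨∑ ij ∈ antidiagonal n,
    (n.choose ij.1 : ℝ) * (‖(dzbar^[ij.2] (dz^[ij.1] H)) m₀‖ + 1), ?_⟩
  filter_upwards [(Filter.eventually_all_finset _).2 hbounded] with m hm z
  rw [dirDeriv, Finset.sum_mul]
  refine (norm_sum_le _ _).trans (Finset.sum_le_sum fun ij hij => ?_)
  rw [norm_mul, norm_mul, norm_mul, norm_pow, norm_pow, RCLike.norm_conj, norm_natCast, ← pow_add,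
    mem_antidiagonal.1 hij, mul_comm (‖z‖ ^ n), mul_assoc]
  gcongr
  exact (hm ij hij).le

lemma inv_factorial_mul_dirDeriv (F : ℂ × ℝ → ℝ) (n : ℕ) (z : ℂ) (u : ℝ) :
    (n.factorial : ℂ)⁻¹ * dirDeriv (fun m => (F m : ℂ)) n z (0, u) =
      ∑ ij ∈ antidiagonal n, coeff F ij.1 ij.2 u * z ^ ij.1 * conj z ^ ij.2 := by
  rw [dirDeriv, Finset.mul_sum]
  refine Finset.sum_congr rfl fun ij hij => ?_
  rw [← mem_antidiagonal.1 hij, coeff, Nat.cast_add_choose]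
  have hfact : ((ij.1 + ij.2).factorial : ℂ) ≠ 0 := Nat.cast_ne_zero.2 (Nat.factorial_ne_zero _)
  field_simp

lemma isBigO_sub_taylor (hD : IsOpen D) {F : ℂ × ℝ → ℝ} (hF : ContDiffOn ℝ (n + 1) F D) {u₀ : ℝ}
    (hu₀ : ((0 : ℂ), u₀) ∈ D) :
    (fun m : ℂ × ℝ => (F m : ℂ) - ∑ k ∈ range (n + 1),
      ∑ ij ∈ antidiagonal k, coeff F ij.1 ij.2 m.2 * m.1 ^ ij.1 * conj m.1 ^ ij.2)
      =O[𝓝 (0, u₀)] fun m => ‖m.1‖ ^ (n + 1) := by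
  have hFC : ContDiffOn ℝ (n + 1) (fun m => (F m : ℂ)) D := ofRealCLM.contDiff.comp_contDiffOn hF
  obtain ⟨B, hB⟩ := eventually_norm_dirDeriv_le (n := n + 1) hD (mod_cast hFC) hu₀
  obtain ⟨r, hr, hball⟩ := Metric.eventually_nhds_iff_ball.1 (hB.and (hD.mem_nhds hu₀))
  refine IsBigO.of_bound B ?_
  filter_upwards [Metric.ball_mem_nhds _ hr] with m hm
  have hmem : ∀ t ∈ Set.Icc (0 : ℝ) 1, ((t : ℂ) * m.1, m.2) ∈ Metric.ball ((0 : ℂ), u₀) r := by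
    intro t ht
    simp only [← ball_prod_same, Set.mem_prod, mem_ball_zero_iff] at hm ⊢
    refine ⟨lt_of_le_of_lt ?_ hm.1, hm.2⟩
    rw [norm_mul, norm_real, Real.norm_of_nonneg ht.1]
    exact mul_le_of_le_one_left (norm_nonneg _) ht.2
  have htaylor := norm_sub_taylor_le hD hFC (fun t ht => (hball _ (hmem t ht)).2)
    fun t ht => (hball _ (hmem t ht)).1 m.1
  simp only [inv_factorial_mul_dirDeriv] at htaylor
  simpa only [norm_pow, norm_norm] using htaylor

end WirtingerTaylor

section Prenormalized

variable {D : Set (ℂ × ℝ)} {F : ℂ × ℝ → ℝ} {u₀ : ℝ}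

lemma pow_four_mul_le {r s : ℝ} (hs : 0 ≤ s) : r ^ 4 * s ≤ r ^ 6 + s ^ 3 := by
  rcases le_total s (r ^ 2) with h | h
  · calc r ^ 4 * s ≤ r ^ 4 * r ^ 2 := by gcongr
      _ = r ^ 6 := by ring
      _ ≤ r ^ 6 + s ^ 3 := le_add_of_nonneg_right (by positivity)
  · calc r ^ 4 * s = (r ^ 2) ^ 2 * s := by ring
      _ ≤ s ^ 2 * s := by gcongr
      _ = s ^ 3 := by ring
      _ ≤ r ^ 6 + s ^ 3 := le_add_of_nonneg_left (by positivity)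

lemma isBigO_coeff_sub (hD : IsOpen D) {j k : ℕ} (hF : ContDiffOn ℝ (j + k + 1) F D)
    (hu₀ : ((0 : ℂ), u₀) ∈ D) :
    (fun u => coeff F j k u - coeff F j k u₀) =O[𝓝 u₀] fun u => u - u₀ := by
  have hFC : ContDiffOn ℝ (j + k + 1) (fun m => (F m : ℂ)) D :=
    ofRealCLM.contDiff.comp_contDiffOn hF
  have hmix : ContDiffOn ℝ (1 : ℕ) (dzbar^[k] (dz^[j] fun m => (F m : ℂ))) D :=
    contDiffOn_iterate_dzbar_iterate_dz hD (by rw [add_comm 1]; exact mod_cast hFC)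
  have haxis : DifferentiableAt ℝ
      (fun u : ℝ => (dzbar^[k] (dz^[j] fun m => (F m : ℂ))) ((0 : ℂ), u)) u₀ :=
    ((hmix.contDiffAt (hD.mem_nhds hu₀)).differentiableAt (by norm_num)).comp u₀ (by fun_prop)
  exact (haxis.div_const _).isBigO_sub

lemma isBigO_coeff_sub_mul (hD : IsOpen D) {j k : ℕ} (hF : ContDiffOn ℝ (j + k + 1) F D)
    (hu₀ : ((0 : ℂ), u₀) ∈ D) (hjk : 4 ≤ j + k) :
    (fun m : ℂ × ℝ => (coeff F j k m.2 - coeff F j k u₀) * m.1 ^ j * conj m.1 ^ k)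
      =O[𝓝 (0, u₀)] fun m => ‖m.1‖ ^ 6 + |m.2 - u₀| ^ 3 := by
  have hcoeff := (isBigO_coeff_sub hD hF hu₀).comp_tendsto
    (continuous_snd.tendsto ((0 : ℂ), u₀))
  have hmono : (fun m : ℂ × ℝ => m.1 ^ j * conj m.1 ^ k) =O[𝓝 (0, u₀)] fun m => ‖m.1‖ ^ 4 := by
    have hnorm : Filter.Tendsto (fun m : ℂ × ℝ => ‖m.1‖) (𝓝 (0, u₀)) (𝓝 0) :=
      (by fun_prop : Continuous fun m : ℂ × ℝ => ‖m.1‖).tendsto' _ _ (by simp)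
    refine (IsBigO.of_bound 1 (.of_forall fun m => ?_)).trans
      ((isBigO_pow_of_le hjk).comp_tendsto hnorm)
    simp [pow_add]
  refine (hcoeff.mul hmono.norm_right |>.congr_left fun m => (mul_assoc _ _ _).symm).trans
    (.of_bound 1 (.of_forall fun m => ?_))
  simpa [mul_comm] using
    (pow_four_mul_le (r := ‖m.1‖) (abs_nonneg (m.2 - u₀))).trans (le_abs_self _)

lemma IsPrenormalizedOn.sum_coeff_eq {J : Set ℝ} (hpre : IsPrenormalizedOn F J) {u : ℝ}
    (hu : u ∈ J) (z : ℂ) :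
    ∑ k ∈ range 6, ∑ ij ∈ antidiagonal k, coeff F ij.1 ij.2 u * z ^ ij.1 * conj z ^ ij.2 =
      z * conj z + (coeff F 2 3 u * z ^ 2 * conj z ^ 3 + coeff F 3 2 u * z ^ 3 * conj z ^ 2) := by
  simp [Finset.sum_range_succ, Finset.Nat.antidiagonal_succ, hpre.coeff_zero_right _ hu,
    hpre.coeff_zero_left _ hu, hpre.coeff_one_one _ hu, hpre.coeff_two_two _ hu,
    hpre.coeff_one_right _ hu, hpre.coeff_one_left _ hu]

lemma IsPrenormalizedOn.isWeightedO6 {J : Set ℝ} (hpre : IsPrenormalizedOn F J) (hJ : J ∈ 𝓝 u₀)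
    (hD : IsOpen D) (hF : ContDiffOn ℝ 6 F D) (hu₀ : ((0 : ℂ), u₀) ∈ D) :
    IsWeightedO6 fun m => F ((0, u₀) + m) - modelFive (coeff F 3 2 u₀) m.1 := by
  have htaylor := (isBigO_sub_taylor (n := 5) hD (mod_cast hF) hu₀).trans
    (k := fun m : ℂ × ℝ => ‖m.1‖ ^ 6 + |m.2 - u₀| ^ 3) (.of_bound 1 (.of_forall fun m => by
      rw [Real.norm_of_nonneg (by positivity), Real.norm_of_nonneg (by positivity), one_mul]
      exact le_add_of_nonneg_right (by positivity)))
  have hfrozen := (htaylor.add (isBigO_coeff_sub_mul (j := 3) (k := 2) hD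
    (mod_cast hF) hu₀ (by norm_num))).add
    (isBigO_coeff_sub_mul (j := 2) (k := 3) hD (mod_cast hF) hu₀ (by norm_num))
  have hJ' : ∀ᶠ m : ℂ × ℝ in 𝓝 (0, u₀), m.2 ∈ J := continuous_snd.tendsto _ hJ
  have hmodel : (fun m : ℂ × ℝ => F m - modelFive (coeff F 3 2 u₀) m.1) =O[𝓝 (0, u₀)]
      fun m => ‖m.1‖ ^ 6 + |m.2 - u₀| ^ 3 := by
    refine IsBigO.trans (.of_bound 1 ?_) hfrozen
    filter_upwards [hJ'] with m hm
    rw [one_mul, modelFive, conj_coeff hD (hF.of_le (by norm_num)) hu₀, ← ofReal_re (F m),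
      ← sub_re]
    refine (abs_re_le_norm _).trans_eq (congr_arg _ ?_)
    rw [hpre.sum_coeff_eq hm, ofReal_re]
    ring
  have hshift : Filter.Tendsto (((0 : ℂ), u₀) + ·) (𝓝 0) (𝓝 (0, u₀)) :=
    (continuous_const_add _).tendsto' _ _ (add_zero _)
  simpa [IsWeightedO6, Function.comp_def] using hmodel.comp_tendsto hshift

end Prenormalized

end MoserChain

end

theorem mainTheorem3_general (D : Set (ℂ × ℝ)) (hD : IsOpen D)
    (F : ℂ × ℝ → ℝ) (hF : ContDiffOn ℝ 6 F D)
    (J : Set ℝ) (h0J : (0 : ℝ) ∈ J)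
    (hchain : MoserChain.IsMoserChain D F J (fun _ => 0) (fun _ => 0)) :
    (∀ a : ℂ,
      MoserChain.IsWeightedO6 (fun m => F m -
        (m.1 * starRingEnd ℂ m.1
          + a * m.1 ^ 3 * starRingEnd ℂ m.1 ^ 2
          + starRingEnd ℂ a * m.1 ^ 2 * starRingEnd ℂ m.1 ^ 3).re) →
      a = 0) ∧
    (MoserChain.IsPrenormalizedOn F J →
      ∀ u ∈ J, MoserChain.coeff F 3 2 u = 0 ∧ MoserChain.coeff F 2 3 u = 0) := by
  have hmem : ∀ u ∈ J, ((0 : ℂ), u) ∈ D := fun u hu => by simpa using hchain.mem u hu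
  have eq_zero : ∀ u ∈ J, ∀ a : ℂ, MoserChain.IsWeightedO6
      (fun m => F ((0, u) + m) - MoserChain.modelFive a m.1) → a = 0 := fun u hu a ha => by
    have hDu := hD.mem_nhds (hmem u hu)
    exact MoserChain.eq_zero_of_mem_chainLocus hDu ((hF.contDiffAt hDu).of_le (by norm_num)) ha
      (by simpa using hchain.jet_mem u hu)
  refine ⟨fun a ha => eq_zero 0 h0J a ?_, fun hpre u hu => ?_⟩
  · simpa only [MoserChain.modelFive, ← Prod.zero_eq_mk, zero_add] using ha
  · have h32 := eq_zero u hu _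
      (hpre.isWeightedO6 (hchain.isOpen.mem_nhds hu) hD hF (hmem u hu))
    refine ⟨h32, ?_⟩
    rw [← MoserChain.conj_coeff hD (hF.of_le (by norm_num)) (hmem u hu), h32, map_zero]

theorem mainTheorem3 (D : Set (ℂ × ℝ)) (hD : IsOpen D)
    (F : ℂ × ℝ → ℝ) (hF : AnalyticOnNhd ℝ F D)
    (J : Set ℝ) (h0J : (0 : ℝ) ∈ J)
    (hF0 : ∀ u ∈ J, F (0, u) = 0)
    (hchain : MoserChain.IsMoserChain D F J (fun _ => 0) (fun _ => 0)) :
    (∀ a : ℂ,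
      MoserChain.IsWeightedO6 (fun m => F m -
        (m.1 * starRingEnd ℂ m.1
          + a * m.1 ^ 3 * starRingEnd ℂ m.1 ^ 2
          + starRingEnd ℂ a * m.1 ^ 2 * starRingEnd ℂ m.1 ^ 3).re) →
      a = 0) ∧
    (MoserChain.IsPrenormalizedOn F J →
      ∀ u ∈ J, MoserChain.coeff F 3 2 u = 0 ∧ MoserChain.coeff F 2 3 u = 0) :=
  mainTheorem3_general D hD F (hF.contDiffOn hD.uniqueDiffOn) J h0J hchain
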